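/- Let $\mathcal{W}=W(2,2)$ be the complex Lie algebra with basis $\{L_n,W_n,z\mid n\in\mathbb{Z}\}$ and brackets $$[L_n,L_m]=(m-n)L_{m+n}+\tfrac{n^3-n}{12}\,\delta_{m+n,0}\,z,\qquad [L_n,W_m]=(m-n)W_{m+n}+\tfrac{n^3-n}{12}\,\delta_{m+n,0}\,z,$$ $$[W_n,W_m]=[z,W_m]=[z,L_m]=0,$$ and let $\mathcal{W}_+$ be the subalgebra spanned by the $L_n$ and $W_n$ with $n>0$. Let $\varphi:\mathcal{W}_+\to\mathbb{C}$ be a Lie algebra homomorphism that is non-singular, i.e. $\varphi(L_i)\varphi(W_i)\neq 0$ for $i=1,2$. Let $\mathbb{C}_\varphi$ be the one-dimensional $\mathcal{W}_+$-module on which each $x\in\mathcal{W}_+$ acts as the scalar $\varphi(x)$, let $$M_\varphi=\mathcal{U}(\mathcal{W})\otimes_{\mathcal{U}(\mathcal{W}_+)}\mathbb{C}_\varphi$$ be the universal Whittaker module of type $\varphi$, where $\mathcal{U}$ denotes the universal enveloping algebra, and let $w=1\otimes 1\in M_\varphi$. A vector $v$ of a $\mathcal{W}$-module is called a Whittaker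 vector (of type $\varphi$) if $xv=\varphi(x)v$ for all $x\in\mathcal{W}_+$. Theorem. Every nonzero submodule $V$ of $M_\varphi$ is isomorphic to $M_\varphi$ as a $\mathcal{W}$-module. Moreover, there is a polynomial $q\in\mathbb{C}[z]$ such that $q(z)w$ is a Whittaker vector and $V$ is generated by $q(z)w$, i.e. $V=\mathcal{U}(\mathcal{W})\,q(z)w$. -/

import Mathlib

open scoped TensorProduct

attribute [local instance 100] LieRing.ofAssociativeRing

noncomputable section

namespace W22

/-- Labels of the basis vectors `L n`, `W n` (`n` an integer) and `z` of the algebra `W(2,2)`. -/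
inductive Gen : Type
  | L (n : ℤ) : Gen
  | W (n : ℤ) : Gen
  | z : Gen

/-- The underlying complex vector space of `W(2,2)`, with basis `L n`, `W n`, `z`. -/
def Alg : Type := Gen →₀ ℂ

instance : AddCommGroup Alg := inferInstanceAs (AddCommGroup (Gen →₀ ℂ))

instance : Module ℂ Alg := inferInstanceAs (Module ℂ (Gen →₀ ℂ))

/-- The basis vector of `W(2,2)` with a given label. -/
def gen (a : Gen) : Alg := Finsupp.single a (1 : ℂ)

/-- The basis vector `L n`. -/
abbrev L (n : ℤ) : Alg := gen (Gen.L n)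

/-- The basis vector `W n`. -/
abbrev W (n : ℤ) : Alg := gen (Gen.W n)

/-- The central basis vector `z`. -/
abbrev z : Alg := gen Gen.z

/-- The coefficient `(n ^ 3 - n) / 12 * δ_{n + m, 0}` of `z` in the brackets. -/
def cocycle (n m : ℤ) : ℂ := if m + n = 0 then ((n : ℂ) ^ 3 - n) / 12 else 0

/-- The brackets of the basis vectors:
`[L n, L m] = (m - n) L (m + n) + (n ^ 3 - n) / 12 δ z`,
`[L n, W m] = (m - n) W (m + n) + (n ^ 3 - n) / 12 δ z`,
`[W n, L m] = - [L m, W n]`, and all other brackets are zero. -/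
def genBracket : Gen → Gen → Alg
  | Gen.L n, Gen.L m => ((m : ℂ) - n) • L (m + n) + cocycle n m • z
  | Gen.L n, Gen.W m => ((m : ℂ) - n) • W (m + n) + cocycle n m • z
  | Gen.W n, Gen.L m => -(((n : ℂ) - m) • W (n + m) + cocycle m n • z)
  | _, _ => 0

/-- The bilinear extension of `genBracket`. -/
def bracketMap : Alg →ₗ[ℂ] Alg →ₗ[ℂ] Alg :=
  Finsupp.linearCombination ℂ fun a =>
    (Finsupp.linearCombination ℂ (genBracket a) : (Gen →₀ ℂ) →ₗ[ℂ] Alg)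

instance : Bracket Alg Alg := ⟨fun x y => bracketMap x y⟩

theorem bracket_def (x y : Alg) : ⁅x, y⁆ = bracketMap x y := rfl

theorem bracketMap_gen (a b : Gen) : bracketMap (gen a) (gen b) = genBracket a b := by
  have h1 : bracketMap (gen a) =
      (Finsupp.linearCombination ℂ (genBracket a) : (Gen →₀ ℂ) →ₗ[ℂ] Alg) := by
    refine (Finsupp.linearCombination_single ℂ (1 : ℂ) a).trans ?_
    exact one_smul ℂ _
  rw [h1]
  refine (Finsupp.linearCombination_single ℂ (1 : ℂ) b).trans ?_
  exact one_smul ℂ _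

/-- The basis vectors span. -/
theorem alg_induction {p : Alg → Prop} (x : Alg) (h0 : p 0)
    (hadd : ∀ x y, p x → p y → p (x + y)) (hsmul : ∀ (c : ℂ) x, p x → p (c • x))
    (hgen : ∀ a, p (gen a)) : p x := by
  refine Finsupp.induction_linear (motive := p) x h0 hadd ?_
  intro a c
  have h : (Finsupp.single a c : Gen →₀ ℂ) = c • (gen a : Gen →₀ ℂ) := by
    refine Eq.symm ((Finsupp.smul_single c a (1 : ℂ)).trans ?_)
    rw [smul_eq_mul, mul_one]
  rw [h]
  exact hsmul c _ (hgen a)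

theorem genBracket_self (a : Gen) : genBracket a a = 0 := by
  cases a with
  | L n =>
    have h : cocycle n n = 0 := by
      unfold cocycle
      split_ifs with h
      · have : n = 0 := by omega
        simp [this]
      · rfl
    simp [genBracket, h]
  | W n => rfl
  | z => rfl

theorem cocycle_symm (n m : ℤ) : cocycle m n = -cocycle n m := by
  unfold cocycle
  by_cases h : m + n = 0
  · obtain rfl : m = -n := by omega
    simp
    ring
  · rw [if_neg h, if_neg (by omega), neg_zero]

theorem genBracket_symm (a b : Gen) : genBracket a b = -genBracket b a := by
  cases a with
  | L n =>
    cases b with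
    | L m =>
      simp only [genBracket, cocycle_symm n m, add_comm m n]
      module
    | W m => simp [genBracket]
    | z => simp [genBracket]
  | W n => cases b <;> simp [genBracket]
  | z => cases b <;> simp [genBracket]

theorem bracketMap_symm (x y : Alg) : bracketMap x y = -bracketMap y x := by
  induction x using alg_induction with
  | h0 => simp
  | hadd x x' hx hx' => simp only [map_add, LinearMap.add_apply, hx, hx']; abel
  | hsmul c x hx => simp only [map_smul, LinearMap.smul_apply, hx, smul_neg]
  | hgen a =>
    induction y using alg_induction with
    | h0 => simp
    | hadd y y' hy hy' => simp only [map_add, LinearMap.add_apply, hy, hy']; abel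
    | hsmul c y hy => simp only [map_smul, LinearMap.smul_apply, hy, smul_neg]
    | hgen b => rw [bracketMap_gen, bracketMap_gen, genBracket_symm]

theorem bracketMap_self (x : Alg) : bracketMap x x = 0 := by
  have h := bracketMap_symm x x
  have h2 : (2 : ℂ) • bracketMap x x = 0 := by
    rw [two_smul]
    nth_rewrite 1 [h]
    simp
  exact (smul_eq_zero.mp h2).resolve_left two_ne_zero

theorem cocycle_jacobi (n m k : ℤ) :
    ((k : ℂ) - m) * cocycle n (k + m) =
      ((m : ℂ) - n) * cocycle (m + n) k + ((k : ℂ) - n) * cocycle m (k + n) := by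
  unfold cocycle
  by_cases h : k + m + n = 0
  · obtain rfl : k = -m - n := by omega
    rw [if_pos (by omega), if_pos (by omega), if_pos (by omega)]
    push_cast
    ring
  · rw [if_neg h, if_neg (by omega), if_neg (by omega)]
    ring

theorem genBracket_LL (n m : ℤ) : genBracket (Gen.L n) (Gen.L m) =
    ((m : ℂ) - n) • L (m + n) + cocycle n m • z := rfl

theorem genBracket_LW (n m : ℤ) : genBracket (Gen.L n) (Gen.W m) =
    ((m : ℂ) - n) • W (m + n) + cocycle n m • z := rfl

theorem genBracket_WL (n m : ℤ) : genBracket (Gen.W n) (Gen.L m) =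
    ((m : ℂ) - n) • W (m + n) + cocycle n m • z := by
  simp only [genBracket, cocycle_symm n m, add_comm m n]
  module

theorem genBracket_WW (n m : ℤ) : genBracket (Gen.W n) (Gen.W m) = 0 := rfl

theorem genBracket_z_left (b : Gen) : genBracket Gen.z b = 0 := by
  cases b <;> rfl

theorem genBracket_z_right (a : Gen) : genBracket a Gen.z = 0 := by
  cases a <;> rfl

theorem jacobi_gen (a b c : Gen) :
    bracketMap (gen a) (genBracket b c) =
      bracketMap (genBracket a b) (gen c) + bracketMap (gen b) (genBracket a c) := by
  cases a <;> cases b <;> cases c <;>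
    simp only [genBracket_LL, genBracket_LW, genBracket_WL, genBracket_WW, genBracket_z_left,
      genBracket_z_right, map_add, map_smul, map_zero, LinearMap.add_apply,
      LinearMap.smul_apply, LinearMap.zero_apply, bracketMap_gen, smul_zero, add_zero]
  all_goals
    rename_i n m k
    have e1 : k + (m + n) = k + m + n := by ring
    have e2 : k + n + m = k + m + n := by ring
    rw [e1, e2]
    have h := cocycle_jacobi n m k
    match_scalars
    · ring
    · linear_combination h

theorem bracketMap_jacobi (x y t : Alg) : bracketMap x (bracketMap y t) =
    bracketMap (bracketMap x y) t + bracketMap y (bracketMap x t) := by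
  induction x using alg_induction with
  | h0 => simp
  | hadd x x' hx hx' => simp only [map_add, LinearMap.add_apply, hx, hx']; abel
  | hsmul c x hx => simp only [map_smul, LinearMap.smul_apply, hx, smul_add]
  | hgen a =>
    induction y using alg_induction with
    | h0 => simp
    | hadd y y' hy hy' => simp only [map_add, LinearMap.add_apply, hy, hy']; abel
    | hsmul c y hy => simp only [map_smul, LinearMap.smul_apply, hy, smul_add]
    | hgen b =>
      induction t using alg_induction with
      | h0 => simp
      | hadd t t' ht ht' => simp only [map_add, ht, ht']; abel
      | hsmul c t ht => simp only [map_smul, ht, smul_add]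
      | hgen c => simp only [bracketMap_gen]; exact jacobi_gen a b c

instance : LieRing Alg where
  add_lie x y t := by simp only [bracket_def, map_add, LinearMap.add_apply]
  lie_add x y t := by simp only [bracket_def, map_add]
  lie_self x := bracketMap_self x
  leibniz_lie x y t := bracketMap_jacobi x y t

instance : LieAlgebra ℂ Alg where
  lie_smul c x y := by simp only [bracket_def, map_smul]

theorem lie_gen (a b : Gen) : ⁅gen a, gen b⁆ = genBracket a b := bracketMap_gen a b

/-- The spanning set `{L n, W n | n > 0}` of `W₊`. -/
def posGens : Set Alg := {x | ∃ n : ℤ, 0 < n ∧ (x = L n ∨ x = W n)}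

theorem posGens_lie {x y : Alg} (hx : x ∈ posGens) (hy : y ∈ posGens) :
    ⁅x, y⁆ ∈ Submodule.span ℂ posGens := by
  obtain ⟨n, hn, hx⟩ := hx
  obtain ⟨m, hm, hy⟩ := hy
  have hc : cocycle n m = 0 := if_neg (by omega)
  have hL : L (m + n) ∈ Submodule.span ℂ posGens :=
    Submodule.subset_span ⟨m + n, by omega, Or.inl rfl⟩
  have hW : W (m + n) ∈ Submodule.span ℂ posGens :=
    Submodule.subset_span ⟨m + n, by omega, Or.inr rfl⟩
  rcases hx with rfl | rfl <;> rcases hy with rfl | rfl <;> rw [lie_gen]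
  · rw [genBracket_LL, hc, zero_smul, add_zero]
    exact Submodule.smul_mem _ _ hL
  · rw [genBracket_LW, hc, zero_smul, add_zero]
    exact Submodule.smul_mem _ _ hW
  · rw [genBracket_WL, hc, zero_smul, add_zero]
    exact Submodule.smul_mem _ _ hW
  · rw [genBracket_WW]
    exact Submodule.zero_mem _

/-- The Lie subalgebra `W₊`, the linear span of the `L n` and `W n` with `n > 0`. -/
def Pos : LieSubalgebra ℂ Alg where
  toSubmodule := Submodule.span ℂ posGens
  lie_mem' := by
    intro x y hx hy
    change x ∈ Submodule.span ℂ posGens at hx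
    change y ∈ Submodule.span ℂ posGens at hy
    change ⁅x, y⁆ ∈ Submodule.span ℂ posGens
    induction hx using Submodule.span_induction with
    | mem x hx =>
      induction hy using Submodule.span_induction with
      | mem y hy => exact posGens_lie hx hy
      | zero => simp
      | add y y' _ _ hy hy' => rw [lie_add]; exact Submodule.add_mem _ hy hy'
      | smul c y _ hy => rw [lie_smul]; exact Submodule.smul_mem _ _ hy
    | zero => simp
    | add x x' _ _ hx hx' => rw [add_lie]; exact Submodule.add_mem _ hx hx'
    | smul c x _ hx => rw [smul_lie]; exact Submodule.smul_mem _ _ hx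

/-- `L n` as an element of `W₊`, for `n > 0`. -/
def posL (n : ℤ) (hn : 0 < n) : Pos := ⟨L n, Submodule.subset_span ⟨n, hn, Or.inl rfl⟩⟩

/-- `W n` as an element of `W₊`, for `n > 0`. -/
def posW (n : ℤ) (hn : 0 < n) : Pos := ⟨W n, Submodule.subset_span ⟨n, hn, Or.inr rfl⟩⟩

/-- A Lie algebra homomorphism `φ : W₊ → ℂ` is non-singular if `φ (L i) φ (W i) ≠ 0` for
`i = 1, 2`. -/
def NonSingular (φ : Pos →ₗ⁅ℂ⁆ ℂ) : Prop :=
  φ (posL 1 (by norm_num)) * φ (posW 1 (by norm_num)) ≠ 0 ∧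
    φ (posL 2 (by norm_num)) * φ (posW 2 (by norm_num)) ≠ 0

/-- The universal enveloping algebra of `W(2,2)`. -/
abbrev U : Type := UniversalEnvelopingAlgebra ℂ Alg

/-- The universal enveloping algebra of `W₊`. -/
abbrev UPos : Type := UniversalEnvelopingAlgebra ℂ Pos

/-- The algebra homomorphism `U(W₊) → U(W)` induced by the inclusion of `W₊`. -/
def inclU : UPos →ₐ[ℂ] U :=
  UniversalEnvelopingAlgebra.lift ℂ ((UniversalEnvelopingAlgebra.ι ℂ).comp Pos.incl)

/-- The one-dimensional space `ℂ_φ`. -/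
def CPhi (_φ : Pos →ₗ⁅ℂ⁆ ℂ) : Type := ℂ

instance (φ : Pos →ₗ⁅ℂ⁆ ℂ) : AddCommGroup (CPhi φ) := inferInstanceAs (AddCommGroup ℂ)

instance (φ : Pos →ₗ⁅ℂ⁆ ℂ) : Module ℂ (CPhi φ) := inferInstanceAs (Module ℂ ℂ)

/-- The action of `U(W₊)` on `ℂ_φ` in which `x ∈ W₊` acts as multiplication by `φ x`. -/
instance (φ : Pos →ₗ⁅ℂ⁆ ℂ) : Module UPos (CPhi φ) :=
  Module.compHom ℂ (UniversalEnvelopingAlgebra.lift ℂ φ : UPos →ₐ[ℂ] ℂ).toRingHom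

/-- The element `1` of `ℂ_φ`. -/
def CPhi.one (φ : Pos →ₗ⁅ℂ⁆ ℂ) : CPhi φ := (1 : ℂ)

theorem CPhi.ι_smul (φ : Pos →ₗ⁅ℂ⁆ ℂ) (x : Pos) (c : CPhi φ) :
    (UniversalEnvelopingAlgebra.ι ℂ x : UPos) • c = φ x • c :=
  congrArg (fun t : ℂ => t • c) (UniversalEnvelopingAlgebra.lift_ι_apply ℂ φ x)

/-- The relations `u n ⊗ c = u ⊗ n c`, with `u ∈ U(W)`, `n ∈ U(W₊)`, `c ∈ ℂ_φ`, which cut out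
`U(W) ⊗_{U(W₊)} ℂ_φ` from `U(W) ⊗_ℂ ℂ_φ`. -/
def balancing (φ : Pos →ₗ⁅ℂ⁆ ℂ) : Submodule U (U ⊗[ℂ] CPhi φ) :=
  Submodule.span U
    {t | ∃ (u : U) (n : UPos) (c : CPhi φ), t = (u * inclU n) ⊗ₜ[ℂ] c - u ⊗ₜ[ℂ] (n • c)}

/-- The induced module `M_φ = U(W) ⊗_{U(W₊)} ℂ_φ`, a left module over `U(W)`. -/
abbrev M (φ : Pos →ₗ⁅ℂ⁆ ℂ) : Type := (U ⊗[ℂ] CPhi φ) ⧸ balancing φ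

/-- The generator `w = 1 ⊗ 1` of `M_φ`. -/
def w (φ : Pos →ₗ⁅ℂ⁆ ℂ) : M φ := (balancing φ).mkQ ((1 : U) ⊗ₜ[ℂ] CPhi.one φ)

/-- A vector `v` of a `U(W)`-module is a Whittaker vector of type `φ` if `x v = φ(x) v` for all
`x ∈ W₊` (the scalar `φ(x)` acts through `ℂ → U(W)`). -/
def IsWhittakerVector (φ : Pos →ₗ⁅ℂ⁆ ℂ) {V : Type*} [AddCommGroup V] [Module U V] (v : V) :
    Prop :=
  ∀ x : Pos, (UniversalEnvelopingAlgebra.ι ℂ (x : Alg) : U) • v = (algebraMap ℂ U (φ x)) • v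

/-- The element `q(z)` of `U(W)`, for a polynomial `q`. -/
def polyZ (q : Polynomial ℂ) : U := Polynomial.aeval (UniversalEnvelopingAlgebra.ι ℂ z : U) q

end W22

end

/-! The argument rests on two facts about the commutative algebra ℂ[z] acting on `w`.

The first is a lowering argument: in any module generated by a Whittaker vector `w`, every nonzero
submodule meets ℂ[z]w nontrivially (`WhittakerFor.exists_aeval_mem`). Vectors are combinations of
words in the L(-j), with j ≥ 0, applied to ℂ[z, W(n)]w, filtered by word length. For k the largest
letter in the leading part, W(k+2) - φ(W(k+2)) acts on that part as differentiation by L(-k): the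
bracket produces -(2k+2)W(2), and φ(W(2)) ≠ 0, while a smaller letter j produces W(k+2-j), whose
eigenvalue vanishes because φ kills everything of index at least 3. This removes all the L(-j). In
the same way L(k+2) - φ(L(k+2)) acts as differentiation by W(-k) and removes the W(-k), leaving a
polynomial in z.

The second is that r(z)w ≠ 0 in the universal module for every r ≠ 0 (`polyZ_smul_w_ne_zero`). It is
enough to have Whittaker vectors of type φ on which z acts by infinitely many different scalars.
These come from free fields (`exists_rep_with_charge`): on a tensor product of two Fock spaces, z
acts by a quadratic polynomial in a free parameter μ.

Given V, let q generate the ideal of all r with r(z)w in V. The first fact, applied to the image of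
V in the quotient by U q(z)w, shows V = U q(z)w (`eq_span_polyZ_smul`). The first fact, applied to
the kernel of multiplication by q(z), together with the second, shows that this multiplication is
injective (`mulPolyZ_injective`), so it is an isomorphism from the universal module onto V. -/

noncomputable section

namespace W22

/-! ### Extracting a leading coefficient by repeated differentiation -/

section LinearAlgebra

variable {N : Type*} [AddCommGroup N] [Module ℂ N]

/-- Over `S`, `x` behaves like multiplication by a variable and `y` like `c` times differentiation
in it, so `D` applications of `y` leave only the top coefficient. -/
theorem pow_apply_sum_range (x y : Module.End ℂ N) (S : Submodule ℂ N) (c : ℂ)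
    (hy : ∀ m ∈ S, y m = 0)
    (hxy : ∀ (i : ℕ), ∀ m ∈ S, y ((x ^ (i + 1)) m) = (((i : ℂ) + 1) * c) • (x ^ i) m)
    (D : ℕ) (f : ℕ → N) (hf : ∀ i, f i ∈ S) :
    (y ^ D) (∑ i ∈ Finset.range (D + 1), (x ^ i) (f i)) = ((D.factorial : ℂ) * c ^ D) • f D := by
  induction D generalizing f with
  | zero => simp
  | succ D ih =>
    rw [pow_succ, Module.End.mul_apply, Finset.sum_range_succ', map_add, pow_zero,
      Module.End.one_apply, hy _ (hf 0), add_zero, map_sum]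
    have h := ih (fun i => (((i : ℂ) + 1) * c) • f (i + 1))
      (fun i => S.smul_mem _ (hf _))
    simp only [map_smul] at h
    rw [Finset.sum_congr rfl fun i _ => hxy i _ (hf (i + 1)), h, smul_smul]
    congr 1
    push_cast [Nat.factorial_succ]
    ring

/-- Expansions in powers of `x` need not be unique. One is fixed, and `d` is the largest exponent in
it with a nonzero coefficient. -/
theorem exists_pow_apply_mem (x y : Module.End ℂ N) (S : Submodule ℂ N) (c : ℂ) (hc : c ≠ 0)
    (hy : ∀ m ∈ S, y m = 0)
    (hxy : ∀ (i : ℕ), ∀ m ∈ S, y ((x ^ (i + 1)) m) = (((i : ℂ) + 1) * c) • (x ^ i) m)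
    (v : N) (hv : v ∈ ⨆ i : ℕ, S.map (x ^ i)) (hv0 : v ≠ 0) :
    ∃ d : ℕ, (y ^ d) v ∈ S ∧ (y ^ d) v ≠ 0 := by
  obtain ⟨f, hf, hfv⟩ := (Submodule.mem_iSup_iff_exists_finsupp _ _).mp hv
  choose g hg hgf using hf
  obtain ⟨D, hD⟩ : ∃ D : ℕ, f.support ⊆ Finset.range (D + 1) := by
    refine ⟨f.support.sup id, fun i hi => ?_⟩
    exact Finset.mem_range.mpr (Nat.lt_succ_of_le (Finset.le_sup (f := id) hi))
  have hsum : v = ∑ i ∈ Finset.range (D + 1), (x ^ i) (g i) := by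
    rw [← hfv, Finsupp.sum_of_support_subset f hD _ (fun _ _ => rfl)]
    exact Finset.sum_congr rfl fun i _ => (hgf i).symm
  clear hfv hgf hD hv
  induction D generalizing v with
  | zero =>
    refine ⟨0, ?_⟩
    have : v = g 0 := by simpa using hsum
    rw [pow_zero, Module.End.one_apply]
    exact ⟨this ▸ hg 0, hv0⟩
  | succ D ih =>
    by_cases h : g (D + 1) = 0
    · rw [Finset.sum_range_succ, h, map_zero, add_zero] at hsum
      exact ih v hv0 hsum
    · refine ⟨D + 1, ?_⟩
      rw [hsum, pow_apply_sum_range x y S c hy hxy _ _ hg]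
      refine ⟨S.smul_mem _ (hg _), smul_ne_zero (mul_ne_zero ?_ (pow_ne_zero _ hc)) h⟩
      exact_mod_cast Nat.factorial_ne_zero _

end LinearAlgebra

/-! ### Removing the operators W(-k) -/

section Representation

variable {N : Type*} [AddCommGroup N] [Module ℂ N] (ρ : Alg →ₗ⁅ℂ⁆ Module.End ℂ N)

theorem rep_comm (x y : Alg) (v : N) : ρ x (ρ y v) = ρ y (ρ x v) + ρ ⁅x, y⁆ v := by
  rw [LieHom.map_lie, LieRing.of_associative_ring_bracket]
  simp

theorem rep_LL (n m : ℤ) (v : N) : ρ (L n) (ρ (L m) v) =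
    ρ (L m) (ρ (L n) v) + (((m : ℂ) - n) • ρ (L (m + n)) v + cocycle n m • ρ z v) := by
  rw [rep_comm, lie_gen, genBracket_LL]; simp

theorem rep_LW (n m : ℤ) (v : N) : ρ (L n) (ρ (W m) v) =
    ρ (W m) (ρ (L n) v) + (((m : ℂ) - n) • ρ (W (m + n)) v + cocycle n m • ρ z v) := by
  rw [rep_comm, lie_gen, genBracket_LW]; simp

theorem rep_WL (n m : ℤ) (v : N) : ρ (W n) (ρ (L m) v) =
    ρ (L m) (ρ (W n) v) + (((m : ℂ) - n) • ρ (W (m + n)) v + cocycle n m • ρ z v) := by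
  rw [rep_comm, lie_gen, genBracket_WL]; simp

theorem rep_WW (n m : ℤ) (v : N) : ρ (W n) (ρ (W m) v) = ρ (W m) (ρ (W n) v) := by
  rw [rep_comm, lie_gen, genBracket_WW]; simp

theorem rep_gen_z (a : Gen) (v : N) : ρ (gen a) (ρ z v) = ρ z (ρ (gen a) v) := by
  rw [rep_comm, lie_gen, genBracket_z_right]; simp

theorem rep_gen_aeval_z (a : Gen) (r : Polynomial ℂ) (v : N) :
    ρ (gen a) (Polynomial.aeval (ρ z) r v) = Polynomial.aeval (ρ z) r (ρ (gen a) v) := by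
  have h : Commute (ρ (gen a)) (ρ z) := LinearMap.ext fun v => rep_gen_z ρ a v
  have h2 : Commute (ρ (gen a)) (Polynomial.aeval (ρ z) r) := by
    induction r using Polynomial.induction_on' with
    | add p q hp hq => rw [map_add]; exact hp.add_right hq
    | monomial n c =>
      rw [Polynomial.aeval_monomial]
      exact (Algebra.commute_algebraMap_right c _).mul_right (h.pow_right n)
  exact LinearMap.congr_fun h2 v

/-- `w` is an eigenvector of all `L n`, `W n` with `n > 0`, with eigenvalues `a n` and `b n`,
where `b` is nonzero at `2` and vanishes beyond. -/
structure WhittakerFor (w : N) (a b : ℤ → ℂ) : Prop where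
  rep_L : ∀ n, 0 < n → ρ (L n) w = a n • w
  rep_W : ∀ n, 0 < n → ρ (W n) w = b n • w
  eq_zero : ∀ n, 3 ≤ n → b n = 0
  ne_zero : b 2 ≠ 0

/-- A subspace stable under the whole Lie algebra. -/
def Stable (S : Submodule ℂ N) : Prop := ∀ a : Gen, ∀ v ∈ S, ρ (gen a) v ∈ S

/-- The space `ℂ[z, W 0, ..., W (-(k - 1))] w`. -/
def wLevel (w : N) : ℕ → Submodule ℂ N
  | 0 => LinearMap.range
      ((LinearMap.applyₗ w : Module.End ℂ N →ₗ[ℂ] N) ∘ₗ (Polynomial.aeval (ρ z)).toLinearMap)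
  | k + 1 => ⨆ i : ℕ, (wLevel w k).map (ρ (W (-(k : ℤ))) ^ i)

variable {ρ} {w : N} {a b : ℤ → ℂ}

theorem mem_wLevel_zero {v : N} :
    v ∈ wLevel ρ w 0 ↔ ∃ r : Polynomial ℂ, Polynomial.aeval (ρ z) r w = v := by
  simp [wLevel]

theorem pow_mem_wLevel_succ {k : ℕ} {v : N} (hv : v ∈ wLevel ρ w k) (i : ℕ) :
    (ρ (W (-(k : ℤ))) ^ i) v ∈ wLevel ρ w (k + 1) :=
  Submodule.mem_iSup_of_mem i (Submodule.mem_map_of_mem hv)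

theorem wLevel_le_succ (k : ℕ) : wLevel ρ w k ≤ wLevel ρ w (k + 1) := fun v hv => by
  simpa using pow_mem_wLevel_succ hv 0

theorem wLevel_mono : Monotone (wLevel ρ w) := monotone_nat_of_le_succ wLevel_le_succ

theorem rep_mem_wLevel_succ {k : ℕ} {v : N} (hv : v ∈ wLevel ρ w (k + 1)) :
    ρ (W (-(k : ℤ))) v ∈ wLevel ρ w (k + 1) := by
  rw [wLevel] at hv
  induction hv using Submodule.iSup_induction' with
  | mem i x hx =>
    obtain ⟨m, hm, rfl⟩ := hx
    rw [← Module.End.mul_apply, ← pow_succ']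
    exact pow_mem_wLevel_succ hm _
  | zero => simp
  | add x y _ _ hx hy => rw [map_add]; exact add_mem hx hy

theorem wLevel_succ_induction {k : ℕ} {p : (v : N) → v ∈ wLevel ρ w (k + 1) → Prop}
    (hbase : ∀ v (hv : v ∈ wLevel ρ w k), p v (wLevel_le_succ k hv))
    (hadd : ∀ u v hu' hv', p u hu' → p v hv' → p (u + v) (add_mem hu' hv'))
    (hstep : ∀ v (hv : v ∈ wLevel ρ w (k + 1)), p v hv →
      p (ρ (W (-(k : ℤ))) v) (rep_mem_wLevel_succ hv))
    {v : N} (hv : v ∈ wLevel ρ w (k + 1)) : p v hv := by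
  suffices ∃ h, p v h from this.2
  rw [wLevel] at hv
  induction hv using Submodule.iSup_induction' with
  | mem i x hx =>
    obtain ⟨m, hm, rfl⟩ := hx
    refine ⟨pow_mem_wLevel_succ hm i, ?_⟩
    induction i with
    | zero => simpa using hbase m hm
    | succ i ih =>
      simp only [pow_succ', Module.End.mul_apply]
      exact hstep _ (pow_mem_wLevel_succ hm i) ih
  | zero => exact ⟨zero_mem _, hbase 0 (zero_mem _)⟩
  | add x y _ _ hx hy => exact ⟨add_mem hx.1 hy.1, hadd _ _ _ _ hx.2 hy.2⟩

theorem rep_z_mem_wLevel (k : ℕ) {v : N} (hv : v ∈ wLevel ρ w k) : ρ z v ∈ wLevel ρ w k := by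
  induction k generalizing v with
  | zero =>
    obtain ⟨r, rfl⟩ := mem_wLevel_zero.mp hv
    exact mem_wLevel_zero.mpr ⟨Polynomial.X * r, by simp⟩
  | succ k ih =>
    induction hv using wLevel_succ_induction with
    | hbase v hv => exact wLevel_le_succ k (ih hv)
    | hadd u v _ _ hu hv => rw [map_add]; exact add_mem hu hv
    | hstep v hv h => rw [← rep_gen_z]; exact rep_mem_wLevel_succ h

theorem WhittakerFor.rep_W_wLevel (hw : WhittakerFor ρ w a b) {n : ℤ} (hn : 0 < n) (k : ℕ) {v : N}
    (hv : v ∈ wLevel ρ w k) : ρ (W n) v = b n • v := by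
  induction k generalizing v with
  | zero =>
    obtain ⟨r, rfl⟩ := mem_wLevel_zero.mp hv
    rw [rep_gen_aeval_z, hw.rep_W n hn, map_smul]
  | succ k ih =>
    induction hv using wLevel_succ_induction with
    | hbase v hv => exact ih hv
    | hadd u v _ _ hu hv => rw [map_add, hu, hv, smul_add]
    | hstep v hv h => rw [rep_WW, h, map_smul]

theorem WhittakerFor.rep_W_mem_wLevel (hw : WhittakerFor ρ w a b) (k : ℕ) {n : ℤ}
    (hn : -(k : ℤ) < n) {v : N} (hv : v ∈ wLevel ρ w k) : ρ (W n) v ∈ wLevel ρ w k := by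
  induction k generalizing v with
  | zero =>
    rw [hw.rep_W_wLevel (by simpa using hn) 0 hv]
    exact Submodule.smul_mem _ _ hv
  | succ k ih =>
    rcases eq_or_lt_of_le (show -(k : ℤ) ≤ n by push_cast at hn; omega) with rfl | h1
    · exact rep_mem_wLevel_succ hv
    · induction hv using wLevel_succ_induction with
      | hbase v hv => exact wLevel_le_succ k (ih h1 hv)
      | hadd u v _ _ hu hv => rw [map_add]; exact add_mem hu hv
      | hstep v hv h => rw [rep_WW]; exact rep_mem_wLevel_succ h

variable (ρ w) in
/-- The space `ℂ[z, W n | n ∈ ℤ] w`. -/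
def wSpan : Submodule ℂ N := ⨆ k, wLevel ρ w k

theorem mem_wSpan {v : N} : v ∈ wSpan ρ w ↔ ∃ k, v ∈ wLevel ρ w k :=
  Submodule.mem_iSup_of_directed _ wLevel_mono.directed_le

theorem self_mem_wSpan : w ∈ wSpan ρ w :=
  mem_wSpan.mpr ⟨0, mem_wLevel_zero.mpr ⟨1, by simp⟩⟩

theorem rep_z_mem_wSpan {v : N} (hv : v ∈ wSpan ρ w) : ρ z v ∈ wSpan ρ w := by
  obtain ⟨k, hk⟩ := mem_wSpan.mp hv
  exact mem_wSpan.mpr ⟨k, rep_z_mem_wLevel k hk⟩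

theorem WhittakerFor.rep_W_mem_wSpan (hw : WhittakerFor ρ w a b) (n : ℤ) {v : N}
    (hv : v ∈ wSpan ρ w) : ρ (W n) v ∈ wSpan ρ w := by
  obtain ⟨k, hk⟩ := mem_wSpan.mp hv
  refine mem_wSpan.mpr ⟨max k (n.natAbs + 1), hw.rep_W_mem_wLevel _ ?_
    (wLevel_mono (le_max_left _ _) hk)⟩
  omega

theorem WhittakerFor.rep_W_wSpan (hw : WhittakerFor ρ w a b) {n : ℤ} (hn : 0 < n) {v : N}
    (hv : v ∈ wSpan ρ w) : ρ (W n) v = b n • v := by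
  obtain ⟨k, hk⟩ := mem_wSpan.mp hv
  exact hw.rep_W_wLevel hn k hk

theorem WhittakerFor.rep_L_mem_wSpan (hw : WhittakerFor ρ w a b) {n : ℤ} (hn : 0 < n) {v : N}
    (hv : v ∈ wSpan ρ w) : ρ (L n) v ∈ wSpan ρ w := by
  obtain ⟨k, hk⟩ := mem_wSpan.mp hv
  clear hv
  induction k generalizing v with
  | zero =>
    refine mem_wSpan.mpr ⟨0, ?_⟩
    obtain ⟨r, rfl⟩ := mem_wLevel_zero.mp hk
    rw [rep_gen_aeval_z, hw.rep_L n hn, map_smul]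
    exact Submodule.smul_mem _ _ hk
  | succ k ih =>
    induction hk using wLevel_succ_induction with
    | hbase v hv => exact ih hv
    | hadd u v _ _ hu hv => rw [map_add]; exact add_mem hu hv
    | hstep v hv h =>
      have hv' : v ∈ wSpan ρ w := mem_wSpan.mpr ⟨_, hv⟩
      rw [rep_LW]
      exact add_mem (hw.rep_W_mem_wSpan _ h) (add_mem
        (Submodule.smul_mem _ _ (hw.rep_W_mem_wSpan _ hv'))
        (Submodule.smul_mem _ _ (rep_z_mem_wSpan hv')))

/-- Moving L(n) past W(-i) with i < k produces W(n-i) of index at least 3, which acts by zero. -/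
theorem WhittakerFor.rep_L_wLevel (hw : WhittakerFor ρ w a b) (k : ℕ) {n : ℤ}
    (hn : (k : ℤ) + 2 ≤ n) {v : N} (hv : v ∈ wLevel ρ w k) : ρ (L n) v = a n • v := by
  induction k generalizing v with
  | zero =>
    obtain ⟨r, rfl⟩ := mem_wLevel_zero.mp hv
    rw [rep_gen_aeval_z, hw.rep_L n (by omega), map_smul]
  | succ k ih =>
    push_cast at hn
    induction hv using wLevel_succ_induction with
    | hbase v hv => exact ih (by omega) hv
    | hadd u v _ _ hu hv => rw [map_add, hu, hv, smul_add]
    | hstep v hv h =>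
      rw [rep_LW, h, hw.rep_W_wLevel (by omega) _ hv, hw.eq_zero _ (by omega), cocycle,
        if_neg (by omega), map_smul]
      simp

/-- The bracket of L(k+2) with W(-k) is -(2k+2)W(2), without central term, and W(2) is the scalar `b
2` here. So the shifted L(k+2) differentiates by W(-k). -/
theorem WhittakerFor.lower_rep_pow (hw : WhittakerFor ρ w a b) (k i : ℕ) {v : N}
    (hv : v ∈ wLevel ρ w k) :
    (ρ (L (k + 2)) - a (k + 2) • 1) ((ρ (W (-(k : ℤ))) ^ (i + 1)) v) =
      (((i : ℂ) + 1) * (-(2 * k + 2) * b 2)) • (ρ (W (-(k : ℤ))) ^ i) v := by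
  have key : ∀ u ∈ wLevel ρ w (k + 1), ρ (L (k + 2)) (ρ (W (-(k : ℤ))) u) =
      ρ (W (-(k : ℤ))) (ρ (L (k + 2)) u) + (-(2 * k + 2) * b 2) • u := by
    intro u hu
    rw [rep_LW, cocycle, if_neg (by omega), show -(k : ℤ) + (k + 2) = 2 by ring,
      hw.rep_W_wLevel (by norm_num) _ hu, zero_smul, add_zero, smul_smul]
    congr 3
    push_cast
    ring
  simp only [LinearMap.sub_apply, LinearMap.smul_apply, Module.End.one_apply]
  induction i with
  | zero =>
    have := key v (wLevel_le_succ k hv)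
    rw [hw.rep_L_wLevel k (by omega) hv, map_smul] at this
    simp [this]
  | succ i ih =>
    have := key _ (pow_mem_wLevel_succ hv (i + 1))
    rw [sub_eq_iff_eq_add] at ih
    rw [pow_succ' _ (i + 1), Module.End.mul_apply, this, ih, map_add, map_smul, map_smul,
      ← Module.End.mul_apply, ← Module.End.mul_apply, ← pow_succ', ← pow_succ']
    push_cast
    module

theorem Stable.pow_lower_mem {V : Submodule ℂ N} (hV : Stable ρ V) (g : Gen) (c : ℂ) (d : ℕ)
    {v : N} (hv : v ∈ V) : ((ρ (gen g) - c • 1) ^ d) v ∈ V := by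
  induction d with
  | zero => simpa
  | succ d ih =>
    rw [pow_succ', Module.End.mul_apply]
    exact sub_mem (hV _ _ ih) (V.smul_mem _ ih)

/-- Descent on the level: each application of `exists_pow_apply_mem` eliminates the variable W(-k)
while staying inside `V`. -/
theorem WhittakerFor.exists_aeval_of_wSpan (hw : WhittakerFor ρ w a b) {V : Submodule ℂ N}
    (hV : Stable ρ V) {v : N} (hv : v ∈ V) (hv0 : v ≠ 0) (hvw : v ∈ wSpan ρ w) :
    ∃ r : Polynomial ℂ, Polynomial.aeval (ρ z) r w ∈ V ∧ Polynomial.aeval (ρ z) r w ≠ 0 := by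
  obtain ⟨k, hk⟩ := mem_wSpan.mp hvw
  clear hvw
  induction k generalizing v with
  | zero =>
    obtain ⟨r, rfl⟩ := mem_wLevel_zero.mp hk
    exact ⟨r, hv, hv0⟩
  | succ k ih =>
    have hc : -(2 * (k : ℂ) + 2) * b 2 ≠ 0 := by
      refine mul_ne_zero (neg_ne_zero.mpr ?_) hw.ne_zero
      exact_mod_cast (show 2 * k + 2 ≠ 0 by omega)
    obtain ⟨d, hd, hd0⟩ := exists_pow_apply_mem (ρ (W (-(k : ℤ)))) (ρ (L (k + 2)) - a (k + 2) • 1)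
      (wLevel ρ w k) _ hc (fun m hm => by simp [hw.rep_L_wLevel k le_rfl hm])
      (fun i m hm => hw.lower_rep_pow k i hm) v hk hv0
    exact ih (hV.pow_lower_mem _ _ d hv) hd0 hd

end Representation

/-! ### Removing the operators L(-j): the filtration by word length -/

section Filtration

variable {N : Type*} [AddCommGroup N] [Module ℂ N] (ρ : Alg →ₗ⁅ℂ⁆ Module.End ℂ N)

/-- The product of the operators `L (-j)`, for `j` in a list. -/
def lWord (l : List ℕ) : Module.End ℂ N := (l.map fun j => ρ (L (-(j : ℤ)))).prod

@[simp] theorem lWord_nil : lWord ρ [] = 1 := rfl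

theorem lWord_cons (j : ℕ) (l : List ℕ) (v : N) :
    lWord ρ (j :: l) v = ρ (L (-(j : ℤ))) (lWord ρ l v) := by
  simp [lWord]

/-- The span of the vectors `L (-j₁) ⋯ L (-jₑ) m` with `e < d` and `m ∈ ℂ[z, W n | n ∈ ℤ] w`. -/
def lFil (w : N) (d : ℕ) : Submodule ℂ N :=
  Submodule.span ℂ {v | ∃ l : List ℕ, l.length < d ∧ ∃ m ∈ wSpan ρ w, v = lWord ρ l m}

variable {ρ} {w : N} {a b : ℤ → ℂ}

theorem lWord_mem_lFil {d : ℕ} {l : List ℕ} (hl : l.length < d) {m : N} (hm : m ∈ wSpan ρ w) :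
    lWord ρ l m ∈ lFil ρ w d := Submodule.subset_span ⟨l, hl, m, hm, rfl⟩

theorem lFil_le_of_forall {d : ℕ} {S : Submodule ℂ N}
    (h : ∀ l : List ℕ, l.length < d → ∀ m ∈ wSpan ρ w, lWord ρ l m ∈ S) : lFil ρ w d ≤ S := by
  refine Submodule.span_le.mpr ?_
  rintro _ ⟨l, hl, m, hm, rfl⟩
  exact h l hl m hm

theorem lFil_mono : Monotone (lFil ρ w) := fun _ _ h =>
  lFil_le_of_forall fun _ hl _ hm => lWord_mem_lFil (hl.trans_le h) hm

/-- The strict length bound puts words of length exactly d in step d+1, so an error in `lFil ρ w d`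
is an error of lower order for them. -/
theorem lFil_zero : lFil ρ w 0 = ⊥ :=
  le_bot_iff.mp (lFil_le_of_forall fun _ hl => absurd hl (Nat.not_lt_zero _))

theorem rep_L_neg_mem_lFil (j d : ℕ) {v : N} (hv : v ∈ lFil ρ w d) :
    ρ (L (-(j : ℤ))) v ∈ lFil ρ w (d + 1) := by
  suffices lFil ρ w d ≤ (lFil ρ w (d + 1)).comap (ρ (L (-(j : ℤ)))) from this hv
  refine lFil_le_of_forall fun l hl m hm => ?_
  rw [Submodule.mem_comap, ← lWord_cons]
  exact lWord_mem_lFil (by simpa using hl) hm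

theorem rep_L_neg_mem_lFil_pred (j d : ℕ) {v : N} (hv : v ∈ lFil ρ w (d - 1)) :
    ρ (L (-(j : ℤ))) v ∈ lFil ρ w d := by
  cases d with
  | zero =>
    rw [Nat.zero_sub, lFil_zero, Submodule.mem_bot] at hv
    simp [hv]
  | succ d => exact rep_L_neg_mem_lFil j d hv

theorem rep_z_lWord (l : List ℕ) (m : N) : ρ z (lWord ρ l m) = lWord ρ l (ρ z m) := by
  induction l with
  | nil => rfl
  | cons j l ih => rw [lWord_cons, lWord_cons, ← rep_gen_z, ih]

theorem rep_z_mem_lFil {d : ℕ} {v : N} (hv : v ∈ lFil ρ w d) : ρ z v ∈ lFil ρ w d := by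
  suffices lFil ρ w d ≤ (lFil ρ w d).comap (ρ z) from this hv
  refine lFil_le_of_forall fun l hl m hm => ?_
  rw [Submodule.mem_comap, rep_z_lWord]
  exact lWord_mem_lFil hl (rep_z_mem_wSpan hm)

/-- A transposition costs a commutator, which is a shorter word plus a central term. Hence leading
parts can be indexed by multisets. -/
theorem lWord_perm {l₁ l₂ : List ℕ} (h : l₁.Perm l₂) {m : N} (hm : m ∈ wSpan ρ w) :
    lWord ρ l₁ m - lWord ρ l₂ m ∈ lFil ρ w l₁.length := by
  induction h with
  | nil => simp
  | cons x h ih =>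
    rw [lWord_cons, lWord_cons, ← map_sub]
    exact rep_L_neg_mem_lFil _ _ ih
  | swap x y l =>
    rw [lWord_cons, lWord_cons, lWord_cons, lWord_cons, rep_LL, add_sub_cancel_left,
      show -(x : ℤ) + -(y : ℤ) = -((x + y : ℕ) : ℤ) by push_cast; ring, ← lWord_cons]
    have h : lWord ρ l m ∈ lFil ρ w (y :: x :: l).length := lWord_mem_lFil (by simp) hm
    exact add_mem (Submodule.smul_mem _ _ (lWord_mem_lFil (by simp) hm))
      (Submodule.smul_mem _ _ (rep_z_mem_lFil h))
  | trans h₁ _ ih₁ ih₂ =>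
    rw [← h₁.length_eq] at ih₂
    simpa using add_mem ih₁ ih₂

theorem WhittakerFor.rep_W_mem_lFil (hw : WhittakerFor ρ w a b) (n : ℤ) {d : ℕ} {v : N}
    (hv : v ∈ lFil ρ w d) : ρ (W n) v ∈ lFil ρ w d := by
  suffices lFil ρ w d ≤ (lFil ρ w d).comap (ρ (W n)) from this hv
  refine lFil_le_of_forall fun l hl m hm => ?_
  clear hv
  rw [Submodule.mem_comap]
  refine lFil_mono hl ?_
  clear hl
  induction l generalizing n with
  | nil => exact lWord_mem_lFil (l := []) Nat.zero_lt_one (hw.rep_W_mem_wSpan n hm)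
  | cons j l ih =>
    rw [lWord_cons, rep_WL]
    have h : lWord ρ l m ∈ lFil ρ w ((j :: l).length + 1) := lWord_mem_lFil (by simp) hm
    exact add_mem (rep_L_neg_mem_lFil _ _ (ih n)) (add_mem
      (Submodule.smul_mem _ _ (lFil_mono (by simp) (ih _)))
      (Submodule.smul_mem _ _ (rep_z_mem_lFil h)))

/-- Each commutator of W(n) with a letter L(-j) uses up that letter, so only the eigenvalue term
keeps the full length. -/
theorem WhittakerFor.rep_W_lWord_sub (hw : WhittakerFor ρ w a b) {n : ℤ} (hn : 0 < n) (l : List ℕ)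
    {m : N} (hm : m ∈ wSpan ρ w) :
    ρ (W n) (lWord ρ l m) - b n • lWord ρ l m ∈ lFil ρ w l.length := by
  induction l with
  | nil => simp [hw.rep_W_wSpan hn hm]
  | cons j l ih =>
    have h : lWord ρ l m ∈ lFil ρ w (j :: l).length := lWord_mem_lFil (by simp) hm
    rw [lWord_cons, rep_WL, add_sub_right_comm, ← map_smul, ← map_sub]
    exact add_mem (rep_L_neg_mem_lFil _ _ ih) (add_mem
      (Submodule.smul_mem _ _ (hw.rep_W_mem_lFil _ h)) (Submodule.smul_mem _ _ (rep_z_mem_lFil h)))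

theorem WhittakerFor.rep_W_sub_mem_lFil (hw : WhittakerFor ρ w a b) {n : ℤ} (hn : 0 < n) {d : ℕ}
    {v : N} (hv : v ∈ lFil ρ w (d + 1)) : (ρ (W n) - b n • 1) v ∈ lFil ρ w d := by
  suffices lFil ρ w (d + 1) ≤ (lFil ρ w d).comap (ρ (W n) - b n • 1) from this hv
  refine lFil_le_of_forall fun l hl m hm => ?_
  exact lFil_mono (Nat.le_of_lt_succ hl) (hw.rep_W_lWord_sub hn l hm)

theorem WhittakerFor.rep_L_mem_lFil (hw : WhittakerFor ρ w a b) {n : ℤ} (hn : 0 < n) {d : ℕ} {v : N}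
    (hv : v ∈ lFil ρ w d) : ρ (L n) v ∈ lFil ρ w d := by
  suffices lFil ρ w d ≤ (lFil ρ w d).comap (ρ (L n)) from this hv
  refine lFil_le_of_forall fun l hl m hm => ?_
  clear hv
  rw [Submodule.mem_comap]
  refine lFil_mono hl ?_
  clear hl
  induction l generalizing n with
  | nil => exact lWord_mem_lFil (l := []) Nat.zero_lt_one (hw.rep_L_mem_wSpan hn hm)
  | cons j l ih =>
    rw [lWord_cons, rep_LL]
    have h : lWord ρ l m ∈ lFil ρ w ((j :: l).length + 1) := lWord_mem_lFil (by simp) hm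
    refine add_mem (rep_L_neg_mem_lFil _ _ (ih hn)) (add_mem
      (Submodule.smul_mem _ _ ?_) (Submodule.smul_mem _ _ (rep_z_mem_lFil h)))
    rcases lt_or_ge 0 (-(j : ℤ) + n) with h1 | h1
    · exact lFil_mono (by simp) (ih h1)
    · obtain ⟨i, hi⟩ := Int.exists_eq_neg_ofNat h1
      rw [hi, ← lWord_cons]
      exact lWord_mem_lFil (by simp) hm

theorem WhittakerFor.iSup_lFil_stable (hw : WhittakerFor ρ w a b) :
    Stable ρ (⨆ d, lFil ρ w d) := by
  intro g v hv
  obtain ⟨d, hd⟩ := (Submodule.mem_iSup_of_directed _ lFil_mono.directed_le).mp hv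
  refine Submodule.mem_iSup_of_mem (d + 1) ?_
  cases g with
  | L n =>
    rcases lt_or_ge 0 n with h1 | h1
    · exact lFil_mono (by omega) (hw.rep_L_mem_lFil h1 hd)
    · obtain ⟨i, rfl⟩ := Int.exists_eq_neg_ofNat h1
      exact rep_L_neg_mem_lFil _ _ hd
  | W n => exact lFil_mono (by omega) (hw.rep_W_mem_lFil n hd)
  | z => exact lFil_mono (by omega) (rep_z_mem_lFil hd)

/-- To leading order the shifted W(k+2) is a derivation. A letter k contributes the scalar -(2k+2)
`b 2`; a letter j < k contributes W(k+2-j), of index at least 3 and hence eigenvalue 0. -/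
theorem WhittakerFor.lower_lWord (hw : WhittakerFor ρ w a b) (k : ℕ) (l : List ℕ)
    (hl : ∀ j ∈ l, j ≤ k) {m : N} (hm : m ∈ wSpan ρ w) :
    (ρ (W (k + 2)) - b (k + 2) • 1) (lWord ρ l m) -
      (l.count k * (-(2 * k + 2) * b 2)) • lWord ρ (l.erase k) m ∈ lFil ρ w (l.length - 1) := by
  induction l with
  | nil => simp [hw.rep_W_wSpan (show (0 : ℤ) < k + 2 by omega) hm]
  | cons j l ih =>
    have hj : j ≤ k := hl j (by simp)
    specialize ih fun i hi => hl i (by simp [hi])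
    have h1 := rep_L_neg_mem_lFil_pred j l.length ih
    have h2 := hw.rep_W_lWord_sub (show (0 : ℤ) < -j + (k + 2) by omega) l hm
    have h3 : (ρ (W (k + 2)) - b (k + 2) • 1) (lWord ρ (j :: l) m) =
        ρ (L (-(j : ℤ))) ((ρ (W (k + 2)) - b (k + 2) • 1) (lWord ρ l m)) +
          (-(j : ℂ) - (k + 2)) • ρ (W (-(j : ℤ) + (k + 2))) (lWord ρ l m) := by
      simp only [LinearMap.sub_apply, LinearMap.smul_apply, Module.End.one_apply]
      rw [lWord_cons, rep_WL, cocycle, if_neg (by omega), map_sub, map_smul]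
      push_cast
      module
    rw [h3, List.length_cons, Nat.add_sub_cancel]
    rcases eq_or_lt_of_le hj with rfl | hlt
    · rw [List.erase_cons_head, List.count_cons_self]
      -- The Leibniz term from the tail has j in front of `l.erase j`; up to shorter words this is
      -- `l` again, so it adds to the term from the head.
      have h4 : (l.count j : ℂ) • (ρ (L (-(j : ℤ))) (lWord ρ (l.erase j) m) - lWord ρ l m) ∈
          lFil ρ w l.length := by
        by_cases hjl : j ∈ l
        · rw [← neg_sub, ← lWord_cons]
          exact Submodule.smul_mem _ _ (neg_mem (lWord_perm (List.perm_cons_erase hjl) hm))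
        · simp [List.count_eq_zero_of_not_mem hjl]
      rw [show -(j : ℤ) + (j + 2) = 2 by ring] at h2 ⊢
      rw [map_sub, map_smul] at h1
      have h5 := add_mem (add_mem h1 (Submodule.smul_mem _ (-(j : ℂ) - (j + 2)) h2))
        (Submodule.smul_mem _ (-(2 * (j : ℂ) + 2) * b 2) h4)
      convert h5 using 1
      push_cast
      module
    · rw [List.erase_cons_tail (by simpa using hlt.ne), List.count_cons_of_ne hlt.ne, lWord_cons]
      rw [hw.eq_zero _ (by omega), zero_smul, sub_zero] at h2
      rw [map_sub, map_smul] at h1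
      have h5 := add_mem h1 (Submodule.smul_mem _ (-(j : ℂ) - (k + 2)) h2)
      convert h5 using 1
      module

theorem WhittakerFor.lower_lWord_toList (hw : WhittakerFor ρ w a b) (k d : ℕ) (J : Multiset ℕ)
    (hd : J.card = d + 1) (hl : ∀ j ∈ J, j ≤ k) {m : N} (hm : m ∈ wSpan ρ w) :
    (ρ (W (k + 2)) - b (k + 2) • 1) (lWord ρ J.toList m) -
      (J.count k * (-(2 * k + 2) * b 2)) • lWord ρ (J.erase k).toList m ∈ lFil ρ w d := by
  have h1 := hw.lower_lWord k J.toList (by simpa using hl) hm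
  rw [Multiset.length_toList, hd, Nat.add_sub_cancel,
    show J.toList.count k = J.count k by rw [← Multiset.coe_count, Multiset.coe_toList]] at h1
  by_cases hk : k ∈ J
  · have hp : (J.toList.erase k).Perm (J.erase k).toList := by
      rw [← Multiset.coe_eq_coe, ← Multiset.coe_erase, Multiset.coe_toList, Multiset.coe_toList]
    have h2 := lWord_perm hp hm
    rw [List.length_erase_of_mem (by simpa using hk), Multiset.length_toList, hd,
      Nat.add_sub_cancel] at h2
    have h3 := add_mem h1 (Submodule.smul_mem _ (J.count k * (-(2 * (k : ℂ) + 2) * b 2)) h2)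
    convert h3 using 1
    module
  · simpa [Multiset.count_eq_zero_of_notMem hk] using h1

/-- The leading part is carried along as a formal sum with nonzero coefficients, so no linear
independence of words is needed. Differentiating by the largest letter present lowers the degree and
keeps the formal sum nonempty; in degree zero the vector equals its one nonzero coefficient. -/
theorem WhittakerFor.exists_mem_wSpan_of_symbol (hw : WhittakerFor ρ w a b) {V : Submodule ℂ N}
    (hV : Stable ρ V) (d : ℕ) (s : Finset (Multiset ℕ)) (hs : s.Nonempty)
    (hcard : ∀ J ∈ s, J.card = d) (m : Multiset ℕ → N)
    (hm : ∀ J ∈ s, m J ∈ wSpan ρ w ∧ m J ≠ 0) (v : N) (hv : v ∈ V)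
    (hvs : v - ∑ J ∈ s, lWord ρ J.toList (m J) ∈ lFil ρ w d) :
    ∃ u ∈ V, u ≠ 0 ∧ u ∈ wSpan ρ w := by
  induction d generalizing s m v with
  | zero =>
    have h0 : ∀ J ∈ s, J = 0 := fun J hJ => Multiset.card_eq_zero.mp (hcard J hJ)
    obtain ⟨J, hJ⟩ := hs
    have hs' : s = {0} := Finset.eq_singleton_iff_unique_mem.mpr ⟨h0 J hJ ▸ hJ, h0⟩
    subst hs'
    rw [lFil_zero, Submodule.mem_bot, sub_eq_zero] at hvs
    simp only [Finset.sum_singleton, Multiset.toList_zero, lWord_nil, Module.End.one_apply] at hvs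
    have h1 := hm 0 (by simp)
    exact ⟨v, hv, hvs ▸ h1.2, hvs ▸ h1.1⟩
  | succ d ih =>
    obtain ⟨J₀, hJ₀⟩ := hs
    obtain ⟨k, hk⟩ : ∃ k, (∃ J ∈ s, k ∈ J) ∧ ∀ J ∈ s, ∀ j ∈ J, j ≤ k := by
      obtain ⟨j, hj⟩ := Multiset.card_pos_iff_exists_mem.mp (by rw [hcard J₀ hJ₀]; omega)
      obtain ⟨k, hk, hmax⟩ := (s.biUnion Multiset.toFinset).exists_max_image id
        ⟨j, by simpa using ⟨J₀, hJ₀, hj⟩⟩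
      refine ⟨k, by simpa using hk, fun J hJ i hi => hmax i ?_⟩
      simpa using ⟨J, hJ, hi⟩
    obtain ⟨⟨J₁, hJ₁, hk₁⟩, hmax⟩ := hk
    have hc : -(2 * (k : ℂ) + 2) * b 2 ≠ 0 := by
      refine mul_ne_zero (neg_ne_zero.mpr ?_) hw.ne_zero
      exact_mod_cast (show 2 * k + 2 ≠ 0 by omega)
    set t := s.filter (k ∈ ·) with ht
    -- Distinct multisets containing k remain distinct after one k is erased, so the new
    -- coefficients cannot cancel.
    have hinj : Set.InjOn (fun J : Multiset ℕ => J.erase k) t := by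
      intro J hJ J' hJ' h
      simp only [ht, Finset.coe_filter, Set.mem_ofPred_eq] at hJ hJ'
      rw [← Multiset.cons_erase hJ.2, ← Multiset.cons_erase hJ'.2]
      exact congrArg _ h
    refine ih (t.image fun J => J.erase k) ⟨J₁.erase k, Finset.mem_image_of_mem _ (by simp [*])⟩
      ?_ (fun J => ((J.count k + 1 : ℕ) * (-(2 * (k : ℂ) + 2) * b 2)) • m (k ::ₘ J)) ?_
      ((ρ (W (k + 2)) - b (k + 2) • 1) v)
      (by simpa using hV.pow_lower_mem (Gen.W (k + 2)) (b (k + 2)) 1 hv) ?_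
    · intro J hJ
      obtain ⟨J', hJ', rfl⟩ := Finset.mem_image.mp hJ
      rw [ht, Finset.mem_filter] at hJ'
      rw [Multiset.card_erase_of_mem hJ'.2, hcard _ hJ'.1, Nat.pred_succ]
    · intro J hJ
      obtain ⟨J', hJ', rfl⟩ := Finset.mem_image.mp hJ
      rw [ht, Finset.mem_filter] at hJ'
      rw [Multiset.cons_erase hJ'.2]
      have h := hm J' hJ'.1
      exact ⟨Submodule.smul_mem _ _ h.1,
        smul_ne_zero (mul_ne_zero (Nat.cast_ne_zero.mpr (Nat.succ_ne_zero _)) hc) h.2⟩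
    · have h1 := hw.rep_W_sub_mem_lFil (show (0 : ℤ) < k + 2 by omega) hvs
      have h2 := Submodule.sum_mem (lFil ρ w d) fun J (hJ : J ∈ s) =>
        hw.lower_lWord_toList k d J (hcard J hJ) (hmax J hJ) (hm J hJ).1
      rw [Finset.sum_sub_distrib] at h2
      rw [map_sub, map_sum] at h1
      have h3 := add_mem h1 h2
      rw [sub_add_sub_cancel] at h3
      rw [Finset.sum_image hinj]
      convert h3 using 2
      rw [ht, Finset.sum_filter]
      refine Finset.sum_congr rfl fun J _ => ?_
      split_ifs with hkJ
      · rw [Multiset.cons_erase hkJ, map_smul, Multiset.count_erase_self,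
          Nat.sub_add_cancel (Multiset.one_le_count_iff_mem.mpr hkJ)]
      · simp [Multiset.count_eq_zero_of_notMem hkJ]

/-- The symbol `f` depends on choices and may be zero, in which case `v` already lies one step
lower. -/
theorem exists_symbol (d : ℕ) {v : N} (hv : v ∈ lFil ρ w (d + 1)) :
    ∃ f : Multiset ℕ →₀ wSpan ρ w, (∀ J ∈ f.support, J.card = d) ∧
      v - f.sum (fun J m => lWord ρ J.toList (m : N)) ∈ lFil ρ w d := by
  classical
  induction hv using Submodule.span_induction with
  | mem v hv =>
    obtain ⟨l, hl, m, hm, rfl⟩ := hv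
    rcases Nat.lt_succ_iff_lt_or_eq.mp hl with h | h
    · exact ⟨0, by simp, by simpa using lWord_mem_lFil h hm⟩
    · refine ⟨Finsupp.single (l : Multiset ℕ) ⟨m, hm⟩, fun J hJ => ?_, ?_⟩
      · rw [Finset.mem_singleton.mp (Finsupp.support_single_subset hJ), Multiset.coe_card, h]
      · rw [Finsupp.sum_single_index (by simp), ← h]
        exact lWord_perm (Multiset.coe_eq_coe.mp (by simp)) hm
  | zero => exact ⟨0, by simp, by simp⟩
  | add u v _ _ hu hv =>
    obtain ⟨f, hf, hf'⟩ := hu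
    obtain ⟨g, hg, hg'⟩ := hv
    refine ⟨f + g, fun J hJ => ?_, ?_⟩
    · rcases Finset.mem_union.mp (Finsupp.support_add hJ) with h | h
      exacts [hf J h, hg J h]
    · rw [Finsupp.sum_add_index' (by simp) (by simp), add_sub_add_comm]
      exact add_mem hf' hg'
  | smul c v _ hv =>
    obtain ⟨f, hf, hf'⟩ := hv
    refine ⟨c • f, fun J hJ => hf J (Finsupp.support_smul hJ), ?_⟩
    rw [Finsupp.sum_smul_index' (by simp)]
    simp only [Submodule.coe_smul, map_smul, ← Finsupp.smul_sum]
    rw [← smul_sub]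
    exact Submodule.smul_mem _ _ hf'

theorem WhittakerFor.exists_mem_wSpan (hw : WhittakerFor ρ w a b) {V : Submodule ℂ N}
    (hV : Stable ρ V) (d : ℕ) {v : N} (hv : v ∈ V) (hv0 : v ≠ 0) (hd : v ∈ lFil ρ w d) :
    ∃ u ∈ V, u ≠ 0 ∧ u ∈ wSpan ρ w := by
  induction d with
  | zero => rw [lFil_zero] at hd; exact absurd hd hv0
  | succ d ih =>
    obtain ⟨f, hf, hf'⟩ := exists_symbol d hd
    by_cases h : f = 0
    · exact ih (by simpa [h] using hf')
    · exact hw.exists_mem_wSpan_of_symbol hV d f.support (Finsupp.support_nonempty_iff.mpr h) hf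
        (fun J => f J) (fun J hJ => ⟨(f J).2, by simpa using hJ⟩) v hv hf'

/-- In a representation generated by a Whittaker vector `w`, every nonzero stable subspace meets
`ℂ[z] w` nontrivially. -/
theorem WhittakerFor.exists_aeval_mem (hw : WhittakerFor ρ w a b)
    (hgen : ∀ S : Submodule ℂ N, Stable ρ S → w ∈ S → S = ⊤) {V : Submodule ℂ N}
    (hV : Stable ρ V) {v : N} (hv : v ∈ V) (hv0 : v ≠ 0) :
    ∃ r : Polynomial ℂ, Polynomial.aeval (ρ z) r w ∈ V ∧ Polynomial.aeval (ρ z) r w ≠ 0 := by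
  have htop := hgen _ hw.iSup_lFil_stable (Submodule.mem_iSup_of_mem 1
    (lWord_mem_lFil (l := []) Nat.zero_lt_one self_mem_wSpan))
  obtain ⟨d, hd⟩ := (Submodule.mem_iSup_of_directed _ lFil_mono.directed_le).mp
    (htop ▸ Submodule.mem_top : v ∈ ⨆ d, lFil ρ w d)
  obtain ⟨u, hu, hu0, huw⟩ := hw.exists_mem_wSpan hV d hv hv0 hd
  exact hw.exists_aeval_of_wSpan hV hu hu0 huw

end Filtration

/-! ### Free field modes and Virasoro operators on Fock space -/

/-- The polynomial Fock space. -/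
abbrev Fock : Type := MvPolynomial ℤ ℂ

namespace Fock

open MvPolynomial

/-- The field modes: creation operators for `m ≤ 0`, shifted annihilation operators for `m > 0`. -/
def mode (ψ : ℤ → ℂ) (m : ℤ) : Module.End ℂ Fock :=
  if m ≤ 0 then LinearMap.mulLeft ℂ (X m : Fock) else (pderiv m : Derivation ℂ Fock Fock).toLinearMap + ψ m • 1

/-- The conjugate field modes. -/
def coMode (m : ℤ) : Module.End ℂ Fock :=
  if m ≤ 0 then (pderiv m : Derivation ℂ Fock Fock).toLinearMap else -LinearMap.mulLeft ℂ (X m : Fock)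

theorem mode_of_nonpos (ψ : ℤ → ℂ) {m : ℤ} (h : m ≤ 0) (p : Fock) : mode ψ m p = X m * p := by
  simp [mode, h]

theorem mode_of_pos (ψ : ℤ → ℂ) {m : ℤ} (h : 0 < m) (p : Fock) :
    mode ψ m p = pderiv m p + ψ m • p := by
  simp [mode, not_le.mpr h]

theorem coMode_of_nonpos {m : ℤ} (h : m ≤ 0) (p : Fock) : coMode m p = pderiv m p := by
  simp [coMode, h]

theorem coMode_of_pos {m : ℤ} (h : 0 < m) (p : Fock) : coMode m p = -(X m * p) := by
  simp [coMode, not_le.mpr h]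

theorem pderiv_pderiv_comm (i j : ℤ) (p : Fock) :
    pderiv i (pderiv j p) = pderiv j (pderiv i p) := by
  have h : ⁅(pderiv i : Derivation ℂ Fock Fock), (pderiv j : Derivation ℂ Fock Fock)⁆ = 0 := by
    refine MvPolynomial.derivation_ext fun k => ?_
    rw [Derivation.commutator_apply]
    by_cases hi : k = i <;> by_cases hj : k = j <;> simp [hi, hj, pderiv_X, Pi.single_apply]
    all_goals split_ifs <;> simp
  have h2 := congrArg (fun D : Derivation ℂ Fock Fock => D p) h
  simpa [Derivation.commutator_apply, sub_eq_zero] using h2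

theorem pderiv_X_mul (i j : ℤ) (p : Fock) :
    pderiv i (X j * p : Fock) = X j * pderiv i p + if i = j then p else 0 := by
  rw [pderiv_mul, pderiv_X, Pi.single_apply]
  simp only [eq_comm (a := j)]
  split_ifs <;> simp [add_comm]

theorem mode_mode (ψ : ℤ → ℂ) (i j : ℤ) (p : Fock) :
    mode ψ i (mode ψ j p) = mode ψ j (mode ψ i p) := by
  rcases le_or_gt i 0 with hi | hi <;> rcases le_or_gt j 0 with hj | hj <;>
    simp only [mode_of_nonpos, mode_of_pos, hi, hj, map_add, Derivation.map_smul]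
  · ring
  · rw [pderiv_X_mul, if_neg (by omega), add_zero, mul_smul_comm]
  · rw [pderiv_X_mul, if_neg (by omega), add_zero, mul_smul_comm]
  · rw [pderiv_pderiv_comm i j]
    module

theorem coMode_coMode (i j : ℤ) (p : Fock) :
    coMode i (coMode j p) = coMode j (coMode i p) := by
  rcases le_or_gt i 0 with hi | hi <;> rcases le_or_gt j 0 with hj | hj <;>
    simp only [coMode_of_nonpos, coMode_of_pos, hi, hj, map_neg]
  · rw [pderiv_pderiv_comm i j]
  · rw [pderiv_X_mul, if_neg (by omega), add_zero]
  · rw [pderiv_X_mul, if_neg (by omega), add_zero]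
  · ring

theorem coMode_mode (ψ : ℤ → ℂ) (i j : ℤ) (p : Fock) :
    coMode i (mode ψ j p) = mode ψ j (coMode i p) + if i = j then p else 0 := by
  rcases le_or_gt i 0 with hi | hi <;> rcases le_or_gt j 0 with hj | hj <;>
    simp only [mode_of_nonpos, mode_of_pos, coMode_of_nonpos, coMode_of_pos, hi, hj, map_add,
      map_neg, Derivation.map_smul]
  · rw [pderiv_X_mul]
  · rw [pderiv_pderiv_comm i j, if_neg (by omega), add_zero]
  · rw [if_neg (by omega)]
    ring
  · rw [pderiv_X_mul]
    simp only [eq_comm (a := j), mul_smul_comm]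
    split_ifs <;> module

/-- The normally ordered product of `mode (m + n)` and `coMode m`. -/
def normalProd (ψ : ℤ → ℂ) (n m : ℤ) : Module.End ℂ Fock :=
  if m ≤ 0 then mode ψ (m + n) * coMode m else coMode m * mode ψ (m + n)

theorem normalProd_of_nonpos (ψ : ℤ → ℂ) (n : ℤ) {m : ℤ} (h : m ≤ 0) (p : Fock) :
    normalProd ψ n m p = mode ψ (m + n) (coMode m p) := by
  simp [normalProd, h]

theorem normalProd_of_pos (ψ : ℤ → ℂ) (n : ℤ) {m : ℤ} (h : 0 < m) (p : Fock) :
    normalProd ψ n m p = coMode m (mode ψ (m + n) p) := by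
  simp [normalProd, not_le.mpr h]

theorem normalProd_mode (ψ : ℤ → ℂ) (n m j : ℤ) (p : Fock) :
    normalProd ψ n m (mode ψ j p) =
      mode ψ j (normalProd ψ n m p) + if m = j then mode ψ (j + n) p else 0 := by
  rcases le_or_gt m 0 with h | h
  · rw [normalProd_of_nonpos ψ n h, normalProd_of_nonpos ψ n h, coMode_mode, map_add, mode_mode]
    split_ifs with hj
    · rw [hj]
    · rw [map_zero]
  · rw [normalProd_of_pos ψ n h, normalProd_of_pos ψ n h, mode_mode, coMode_mode]
    split_ifs with hj
    · rw [hj]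
    · rfl

theorem normalProd_coMode (ψ : ℤ → ℂ) (n m j : ℤ) (p : Fock) :
    normalProd ψ n m (coMode j p) =
      coMode j (normalProd ψ n m p) - if m = j - n then coMode (j - n) p else 0 := by
  have hiff : j = m + n ↔ m = j - n := by omega
  rcases le_or_gt m 0 with h | h
  · rw [normalProd_of_nonpos ψ n h, normalProd_of_nonpos ψ n h, coMode_mode, coMode_coMode]
    simp only [hiff]
    split_ifs with hj
    · rw [hj, add_sub_cancel_right]
    · simp
  · rw [normalProd_of_pos ψ n h, normalProd_of_pos ψ n h,
      eq_sub_of_add_eq (coMode_mode ψ j (m + n) p).symm, map_sub, coMode_coMode m j]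
    simp only [hiff]
    split_ifs with hj
    · rw [hj]
    · simp

/-- For m ≤ 0 the derivative by `X m` must meet a variable of `p`. For m > 0 either `X (m + n)`
occurs in `p` or m + n ≤ 2, where `ψ` may be nonzero. -/
theorem finite_normalProd {ψ : ℤ → ℂ} (hψ : ∀ n, 3 ≤ n → ψ n = 0) (n : ℤ) (p : Fock) :
    {m | normalProd ψ n m p ≠ 0}.Finite := by
  refine ((p.vars.finite_toSet.union (p.vars.finite_toSet.image (· - n))).union
    (Set.finite_Icc 1 (2 - n))).subset fun m hm => ?_
  by_contra hcon
  simp only [Set.mem_union, Set.mem_image, Finset.mem_coe, Set.mem_Icc, not_or, not_exists,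
    not_and] at hcon
  obtain ⟨⟨h1, h2⟩, h3⟩ := hcon
  apply hm
  rcases le_or_gt m 0 with h | h
  · rw [normalProd_of_nonpos ψ n h, coMode_of_nonpos h, pderiv_eq_zero_of_notMem_vars h1, map_zero]
  · have h4 : 3 ≤ m + n := by by_contra; exact h3 (by omega) (by omega)
    have h5 : m + n ∉ p.vars := fun h5 => h2 _ h5 (by ring)
    rw [normalProd_of_pos ψ n h, mode_of_pos ψ (by omega), hψ _ h4,
      pderiv_eq_zero_of_notMem_vars h5, zero_smul, add_zero, map_zero]

/-- The coefficients of the action of the Witt algebra on a density module. -/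
def density (μ : ℂ) (n m : ℤ) : ℂ := m + μ - 1 - μ * n

theorem density_comm (μ : ℂ) (n k m : ℤ) :
    density μ k m * density μ n (m + k) - density μ n m * density μ k (m + n) =
      ((k : ℂ) - n) * density μ (k + n) m := by
  unfold density
  push_cast
  ring

variable {ψ : ℤ → ℂ} (hψ : ∀ n, 3 ≤ n → ψ n = 0) (μ : ℂ)

theorem finite_density_normalProd {ψ : ℤ → ℂ} (hψ : ∀ n, 3 ≤ n → ψ n = 0) (μ : ℂ) (n : ℤ)
    (p : Fock) : Function.HasFiniteSupport fun m => density μ n m • normalProd ψ n m p :=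
  (finite_normalProd hψ n p).subset fun _ hm h => hm (by simp [h])

/-- The Virasoro operators of a free field, up to the normalization of the zeroth one. -/
def vir (n : ℤ) : Module.End ℂ Fock where
  toFun p := ∑ᶠ m, density μ n m • normalProd ψ n m p
  map_add' p q := by
    rw [← finsum_add_distrib (finite_density_normalProd hψ μ n p)
      (finite_density_normalProd hψ μ n q)]
    simp only [map_add, smul_add]
  map_smul' c p := by
    rw [RingHom.id_apply, smul_finsum' c (finite_density_normalProd hψ μ n p)]
    simp only [map_smul, smul_comm c]

theorem vir_apply (n : ℤ) (p : Fock) :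
    vir hψ μ n p = ∑ᶠ m, density μ n m • normalProd ψ n m p := rfl

theorem map_vir {E : Type*} [AddCommGroup E] [Module ℂ E] (f : Fock →ₗ[ℂ] E) (n : ℤ) (p : Fock) :
    f (vir hψ μ n p) = ∑ᶠ m, density μ n m • f (normalProd ψ n m p) := by
  rw [vir_apply, map_finsum f (finite_density_normalProd hψ μ n p)]
  simp only [map_smul]

theorem finsum_density_ite (n j : ℤ) (q : Fock) :
    ∑ᶠ m, density μ n m • (if m = j then q else 0) = density μ n j • q := by
  rw [finsum_eq_single _ j (fun m hm => by simp [hm]), if_pos rfl]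

theorem vir_mode (n j : ℤ) (p : Fock) : vir hψ μ n (mode ψ j p) =
    mode ψ j (vir hψ μ n p) + density μ n j • mode ψ (j + n) p := by
  rw [map_vir, vir_apply, ← finsum_density_ite, ← finsum_add_distrib]
  · simp only [normalProd_mode, smul_add]
  · exact (finite_normalProd hψ n p).subset fun _ hm h => hm (by simp [h])
  · exact (Set.finite_singleton j).subset fun m hm => by
      by_contra h
      exact hm (by simp [show m ≠ j from h])

theorem vir_coMode (n j : ℤ) (p : Fock) : vir hψ μ n (coMode j p) =
    coMode j (vir hψ μ n p) - density μ n (j - n) • coMode (j - n) p := by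
  rw [map_vir, vir_apply, ← finsum_density_ite, ← finsum_sub_distrib]
  · simp only [normalProd_coMode, smul_sub]
  · exact (finite_normalProd hψ n p).subset fun _ hm h => hm (by simp [h])
  · exact (Set.finite_singleton (j - n)).subset fun m hm => by
      by_contra h
      exact hm (by simp [show m ≠ j - n from h])

/-- Schur's lemma for the Weyl algebra: `T` commutes with all variables and all partial derivatives.
So every derivative of `T 1` vanishes, `T 1` is constant, and multiplication by variables determines
`T`. -/
theorem apply_eq_smul_of_commute (ψ : ℤ → ℂ) (T : Module.End ℂ Fock)
    (h₁ : ∀ j p, T (mode ψ j p) = mode ψ j (T p)) (h₂ : ∀ j p, T (coMode j p) = coMode j (T p))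
    (p : Fock) : T p = constantCoeff (T 1) • p := by
  have hX : ∀ j p, T (X j * p) = X j * T p := fun j p => by
    rcases le_or_gt j 0 with hj | hj
    · simpa only [mode_of_nonpos ψ hj] using h₁ j p
    · simpa only [coMode_of_pos hj, map_neg, neg_inj] using h₂ j p
  have hd : ∀ j p, T (pderiv j p) = pderiv j (T p) := fun j p => by
    rcases le_or_gt j 0 with hj | hj
    · simpa only [coMode_of_nonpos hj] using h₂ j p
    · simpa only [mode_of_pos ψ hj, map_add, map_smul, add_left_inj] using h₁ j p
  have h1 : T 1 = C (constantCoeff (T 1)) := by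
    ext s
    rw [coeff_C]
    split_ifs with hs
    · rw [← hs]; rfl
    · obtain ⟨j, hj⟩ : ∃ j, s j ≠ 0 := by
        by_contra! hcon
        exact hs (Finsupp.ext fun j => (hcon j).symm)
      have h := congrArg (coeff (s - Finsupp.single j 1)) (hd j 1)
      have hle : Finsupp.single j 1 ≤ s := by
        simpa using Nat.one_le_iff_ne_zero.mpr hj
      rw [pderiv_one, map_zero, coeff_zero, coeff_pderiv, tsub_add_cancel_of_le hle] at h
      refine (mul_eq_zero.mp h.symm).resolve_right ?_
      norm_cast
  rw [MvPolynomial.smul_eq_C_mul, ← h1]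
  induction p using MvPolynomial.induction_on with
  | C c => rw [mul_comm, ← MvPolynomial.smul_eq_C_mul, ← map_smul, MvPolynomial.smul_eq_C_mul, mul_one]
  | add p q hp hq => rw [map_add, hp, hq, mul_add]
  | mul_X p j hp => rw [mul_comm p, hX, hp]; ring

/-! ### The central charge, computed from vacuum expectations -/

/-- The defect of the Witt algebra relations. -/
def anomaly (n k : ℤ) : Module.End ℂ Fock :=
  vir hψ μ n * vir hψ μ k - vir hψ μ k * vir hψ μ n - ((k : ℂ) - n) • vir hψ μ (k + n)

theorem anomaly_apply (n k : ℤ) (p : Fock) : anomaly hψ μ n k p =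
    vir hψ μ n (vir hψ μ k p) - vir hψ μ k (vir hψ μ n p) -
      ((k : ℂ) - n) • vir hψ μ (k + n) p := rfl

theorem anomaly_mode (n k j : ℤ) (p : Fock) :
    anomaly hψ μ n k (mode ψ j p) = mode ψ j (anomaly hψ μ n k p) := by
  simp only [anomaly_apply, vir_mode, map_add, map_sub, map_smul]
  have h := density_comm μ n k j
  rw [show j + (k + n) = j + k + n by ring, show j + n + k = j + k + n by ring]
  match_scalars
  all_goals first | ring1 | linear_combination h

theorem anomaly_coMode (n k j : ℤ) (p : Fock) :
    anomaly hψ μ n k (coMode j p) = coMode j (anomaly hψ μ n k p) := by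
  simp only [anomaly_apply, vir_coMode, map_sub, map_smul]
  have h := density_comm μ n k (j - (k + n))
  rw [show j - (k + n) + k = j - n by ring, show j - (k + n) + n = j - k by ring] at h
  rw [show j - k - n = j - (k + n) by ring, show j - n - k = j - (k + n) by ring]
  match_scalars
  all_goals first | ring1 | linear_combination -h

theorem constantCoeff_mode {j : ℤ} (hj : j ≤ 0) (p : Fock) :
    constantCoeff (mode ψ j p) = 0 := by
  simp [mode_of_nonpos ψ hj]

theorem constantCoeff_coMode {j : ℤ} (hj : 0 < j) (p : Fock) :
    constantCoeff (coMode j p) = 0 := by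
  simp [coMode_of_pos hj]

theorem coMode_one {j : ℤ} (hj : j ≤ 0) : coMode j 1 = 0 := by
  rw [coMode_of_nonpos hj, pderiv_one]

theorem mode_one {j : ℤ} (hj : 0 < j) : mode ψ j 1 = ψ j • 1 := by
  rw [mode_of_pos ψ hj, pderiv_one, zero_add]

theorem constantCoeff_finsum {f : ℤ → Fock} (hf : Function.HasFiniteSupport f) :
    constantCoeff (∑ᶠ m, f m) = ∑ᶠ m, constantCoeff (f m) :=
  map_finsum (constantCoeff : Fock →+* ℂ) hf

theorem constantCoeff_vir {n : ℤ} (hn : n ≤ 0) (p : Fock) : constantCoeff (vir hψ μ n p) = 0 := by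
  rw [vir_apply, constantCoeff_finsum (finite_density_normalProd hψ μ n p)]
  refine finsum_eq_zero_of_forall_eq_zero fun m => ?_
  rw [constantCoeff_smul]
  rcases le_or_gt m 0 with h | h
  · rw [normalProd_of_nonpos ψ n h, constantCoeff_mode (by omega), smul_zero]
  · rw [normalProd_of_pos ψ n h, constantCoeff_coMode h, smul_zero]

theorem vir_one {n : ℤ} (hn : 0 < n) : vir hψ μ n 1 = 0 := by
  rw [vir_apply]
  refine finsum_eq_zero_of_forall_eq_zero fun m => ?_
  rcases le_or_gt m 0 with h | h
  · rw [normalProd_of_nonpos ψ n h, coMode_one h, map_zero, smul_zero]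
  · rw [normalProd_of_pos ψ n h, mode_one (by omega)]
    by_cases h3 : 3 ≤ m + n
    · rw [hψ _ h3, zero_smul, map_zero, smul_zero]
    -- The one term in which `ψ 2` could survive is m = n = 1, and there the density coefficient is
    -- zero.
    · obtain rfl : m = 1 := by omega
      obtain rfl : n = 1 := by omega
      simp [density]

/-- A term of the inner sum survives only when its creation operator `coMode m` is turned by the
outer operator into the annihilator `coMode (m - n)`, paired with `mode ψ (m + k)`. This forces 1 ≤
m ≤ n and k = -n. -/
theorem constantCoeff_vir_vir (n k : ℤ) :
    constantCoeff (vir hψ μ n (vir hψ μ k 1)) =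
      if k + n = 0 then -∑ m ∈ Finset.Icc 1 n, density μ k m * density μ n (m - n) else 0 := by
  have key : ∀ m, constantCoeff (vir hψ μ n (normalProd ψ k m 1)) =
      if m ∈ Finset.Icc 1 n ∧ k + n = 0 then -density μ n (m - n) else 0 := by
    intro m
    rcases le_or_gt m 0 with h | h
    · rw [normalProd_of_nonpos ψ k h, coMode_one h, map_zero, map_zero, map_zero, if_neg]
      simp only [Finset.mem_Icc]
      omega
    · rw [normalProd_of_pos ψ k h, vir_coMode, map_sub, constantCoeff_coMode h, zero_sub,
        constantCoeff_smul]
      rcases le_or_gt (m - n) 0 with h1 | h1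
      · rw [coMode_mode, coMode_one h1, map_zero, zero_add]
        by_cases h2 : k + n = 0
        · rw [if_pos (by omega), if_pos ⟨Finset.mem_Icc.mpr ⟨h, by omega⟩, h2⟩]
          simp
        · rw [if_neg (by omega), if_neg (fun h3 => h2 h3.2)]
          simp
      · rw [constantCoeff_coMode h1, if_neg]
        · simp
        · simp only [Finset.mem_Icc]
          omega
  have h1 := map_vir hψ μ (((MvPolynomial.aeval (0 : ℤ → ℂ)).toLinearMap) ∘ₗ vir hψ μ n) k 1
  simp only [LinearMap.comp_apply, AlgHom.toLinearMap_apply, MvPolynomial.aeval_zero, Algebra.algebraMap_self,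
    RingHom.id_apply] at h1
  rw [h1]
  simp only [key]
  by_cases h2 : k + n = 0
  · rw [if_pos h2, finsum_eq_sum_of_support_subset (s := Finset.Icc 1 n), ← Finset.sum_neg_distrib]
    · refine Finset.sum_congr rfl fun m hm => ?_
      rw [if_pos ⟨hm, h2⟩, smul_eq_mul, mul_neg]
    · intro m hm
      by_contra h3
      exact hm (by simp only [if_neg (fun h4 : m ∈ Finset.Icc 1 n ∧ k + n = 0 => h3 h4.1), smul_zero])
  · rw [if_neg h2]
    exact finsum_eq_zero_of_forall_eq_zero fun m => by simp [h2]

theorem sum_Icc_add_mul_sub (A B : ℂ) (n : ℕ) :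
    ∑ m ∈ Finset.Icc (1 : ℤ) n, ((m : ℂ) + A) * (m - B) =
      n * (n + 1) * (2 * n + 1) / 6 + (A - B) * (n * (n + 1) / 2) - A * B * n := by
  induction n with
  | zero => simp
  | succ n ih =>
    have h : Finset.Icc (1 : ℤ) ((n + 1 : ℕ) : ℤ) = insert ((n : ℤ) + 1) (Finset.Icc 1 (n : ℤ)) := by
      ext i
      simp only [Finset.mem_Icc, Finset.mem_insert]
      omega
    rw [h, Finset.sum_insert (by simp), ih]
    push_cast
    ring

/-- The central charge of `vir`. -/
def charge (μ : ℂ) : ℂ := 12 * μ ^ 2 + 12 * μ + 2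

theorem sum_density {n k : ℤ} (hn : 0 < n) (h : k + n = 0) :
    -∑ m ∈ Finset.Icc 1 n, density μ k m * density μ n (m - n) =
      charge μ * cocycle n k + 2 * μ * n := by
  obtain ⟨n, rfl⟩ := Int.eq_ofNat_of_zero_le hn.le
  obtain rfl : k = -n := by omega
  have h := sum_Icc_add_mul_sub (μ * (n + 1) - 1) (n * (1 + μ) + 1 - μ) n
  have h2 : ∑ m ∈ Finset.Icc (1 : ℤ) n, density μ (-n) m * density μ n (m - n) =
      ∑ m ∈ Finset.Icc (1 : ℤ) n, ((m : ℂ) + (μ * (n + 1) - 1)) * (m - (n * (1 + μ) + 1 - μ)) := by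
    refine Finset.sum_congr rfl fun m _ => ?_
    unfold density
    push_cast
    ring
  rw [h2, h, cocycle, if_pos (by ring), charge]
  push_cast
  ring

/-- The anomaly commutes with all modes, hence is a scalar, and that scalar is the constant term of
its value at the vacuum 1. -/
theorem vir_vir (n k : ℤ) (p : Fock) :
    vir hψ μ n (vir hψ μ k p) = vir hψ μ k (vir hψ μ n p) +
      ((k : ℂ) - n) • vir hψ μ (k + n) p +
        (charge μ * cocycle n k + if k + n = 0 then 2 * μ * n else 0) • p := by
  have h0 : ∀ n, constantCoeff (vir hψ μ n 1) = 0 := fun n => by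
    rcases le_or_gt n 0 with h | h
    · exact constantCoeff_vir hψ μ h 1
    · rw [vir_one hψ μ h, map_zero]
  have h1 := apply_eq_smul_of_commute ψ (anomaly hψ μ n k) (anomaly_mode hψ μ n k)
    (anomaly_coMode hψ μ n k) p
  have h2 : constantCoeff (anomaly hψ μ n k 1) =
      charge μ * cocycle n k + if k + n = 0 then 2 * μ * n else 0 := by
    rw [anomaly_apply, map_sub, map_sub, constantCoeff_smul, h0, smul_zero, sub_zero]
    rcases le_or_gt n 0 with hn | hn <;> rcases le_or_gt k 0 with hk | hk
    · rw [constantCoeff_vir hψ μ hn, constantCoeff_vir hψ μ hk, cocycle]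
      split_ifs with h
      · obtain rfl : n = 0 := by omega
        simp
      · simp
    · rw [constantCoeff_vir hψ μ hn, constantCoeff_vir_vir, add_comm n k]
      split_ifs with h
      · rw [sum_density μ hk (by omega), cocycle_symm n k]
        obtain rfl : n = -k := by omega
        push_cast
        ring
      · simp [cocycle, h]
    · rw [constantCoeff_vir hψ μ hk, constantCoeff_vir_vir]
      split_ifs with h
      · rw [sum_density μ hn h, sub_zero]
      · simp [cocycle, h]
    · rw [vir_one hψ μ hn, vir_one hψ μ hk, cocycle, if_neg (by omega), if_neg (by omega)]
      simp
  rw [h2, anomaly_apply, sub_eq_iff_eq_add, sub_eq_iff_eq_add] at h1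
  rw [h1]
  abel

/-! ### Normalized and deformed Virasoro operators -/

/-- The Virasoro operators of a free field. -/
def virN (n : ℤ) : Module.End ℂ Fock := vir hψ μ n - (if n = 0 then μ else 0) • 1

theorem virN_apply (n : ℤ) (p : Fock) :
    virN hψ μ n p = vir hψ μ n p - (if n = 0 then μ else 0) • p := rfl

theorem virN_one {n : ℤ} (hn : 0 < n) : virN hψ μ n 1 = 0 := by
  rw [virN_apply, vir_one hψ μ hn, if_neg hn.ne', zero_smul, sub_zero]

theorem virN_mode (n j : ℤ) (p : Fock) : virN hψ μ n (mode ψ j p) =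
    mode ψ j (virN hψ μ n p) + density μ n j • mode ψ (j + n) p := by
  simp only [virN_apply, vir_mode, map_sub, map_smul]
  abel

theorem virN_coMode (n j : ℤ) (p : Fock) : virN hψ μ n (coMode j p) =
    coMode j (virN hψ μ n p) - density μ n (j - n) • coMode (j - n) p := by
  simp only [virN_apply, vir_coMode, map_sub, map_smul]
  abel

/-- Shifting the zeroth operator by `μ` absorbs the linear term 2μn of the anomaly. -/
theorem virN_virN (n k : ℤ) (p : Fock) :
    virN hψ μ n (virN hψ μ k p) = virN hψ μ k (virN hψ μ n p) +
      ((k : ℂ) - n) • virN hψ μ (k + n) p + (charge μ * cocycle n k) • p := by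
  simp only [virN_apply, map_sub, map_smul]
  rw [vir_vir]
  by_cases h : k + n = 0
  · obtain rfl : k = -n := by omega
    simp only [h, if_true]
    push_cast
    module
  · simp only [h, if_false]
    module

/-- The modes of `vir` for `μ = 1`, deformed by a multiple of `coMode`. -/
def virW (c : ℂ) (n : ℤ) : Module.End ℂ Fock :=
  virN hψ 1 n + (c * (((n : ℂ) ^ 3 - n) / 12)) • coMode (-n)

theorem virW_apply (c : ℂ) (n : ℤ) (p : Fock) :
    virW hψ c n p = virN hψ 1 n p + (c * (((n : ℂ) ^ 3 - n) / 12)) • coMode (-n) p := rfl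

theorem virW_one (c : ℂ) {n : ℤ} (hn : 0 < n) : virW hψ c n 1 = 0 := by
  rw [virW_apply, virN_one hψ 1 hn, coMode_one (by omega), smul_zero, add_zero]

/-- For μ = 1 the density coefficient is j - n, as in the bracket of L(n) with W(j). The `coMode`
term pairs with `mode ψ j` to give the central term. -/
theorem virW_mode (c : ℂ) (n j : ℤ) (p : Fock) : virW hψ c n (mode ψ j p) =
    mode ψ j (virW hψ c n p) + ((j : ℂ) - n) • mode ψ (j + n) p + (c * cocycle n j) • p := by
  simp only [virW_apply, virN_mode, coMode_mode, map_add, map_smul, cocycle, density]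
  by_cases h : j + n = 0
  · rw [if_pos (by omega), if_pos h]
    module
  · rw [if_neg (by omega), if_neg h]
    module

/-- The deformation leaves the charge unchanged because n ↦ (n³ - n)/12 satisfies the cocycle
identity for the action on conjugate modes. -/
theorem virW_virW (c : ℂ) (n k : ℤ) (p : Fock) :
    virW hψ c n (virW hψ c k p) = virW hψ c k (virW hψ c n p) +
      ((k : ℂ) - n) • virW hψ c (k + n) p + (charge 1 * cocycle n k) • p := by
  simp only [virW_apply, virN_coMode, map_add, map_smul, density]
  rw [virN_virN, coMode_coMode (-k) (-n), show -k - n = -(k + n) by ring,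
    show -n - k = -(k + n) by ring]
  push_cast
  module

/-- The modes of `vir` twisted by the coboundary of a multiple of `mode 0`. -/
def virT (θ : ℂ) (n : ℤ) : Module.End ℂ Fock := virN hψ μ n + (θ * density μ n 0) • mode ψ n

theorem virT_apply (θ : ℂ) (n : ℤ) (p : Fock) :
    virT hψ μ θ n p = virN hψ μ n p + (θ * density μ n 0) • mode ψ n p := rfl

theorem virT_one (θ : ℂ) {n : ℤ} (hn : 0 < n) :
    virT hψ μ θ n 1 = (θ * density μ n 0 * ψ n) • 1 := by
  rw [virT_apply, virN_one hψ μ hn, mode_one hn, smul_smul, zero_add]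

/-- The modes commute, and the cross terms assemble by the identity of `density_comm` at m = 0. -/
theorem virT_virT (θ : ℂ) (n k : ℤ) (p : Fock) :
    virT hψ μ θ n (virT hψ μ θ k p) = virT hψ μ θ k (virT hψ μ θ n p) +
      ((k : ℂ) - n) • virT hψ μ θ (k + n) p + (charge μ * cocycle n k) • p := by
  simp only [virT_apply, virN_mode, map_add, map_smul, density]
  rw [virN_virN, mode_mode ψ k n, add_comm n k]
  push_cast
  module

end Fock

/-! ### Representations from operators satisfying the relations -/

section RepOfOperators

variable {N : Type*} [AddCommGroup N] [Module ℂ N] (l s : ℤ → Module.End ℂ N) (c : ℂ)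

/-- The operator attached to a basis vector, where `z` acts by the scalar `c`. -/
def genOp : Gen → Module.End ℂ N
  | Gen.L n => l n
  | Gen.W n => s n
  | Gen.z => c • 1

/-- The linear extension of `genOp`. -/
def opMap : Alg →ₗ[ℂ] Module.End ℂ N :=
  (Finsupp.linearCombination ℂ (genOp l s c) : (Gen →₀ ℂ) →ₗ[ℂ] Module.End ℂ N)

theorem opMap_gen (a : Gen) : opMap l s c (gen a) = genOp l s c a :=
  (Finsupp.linearCombination_single ℂ (1 : ℂ) a).trans (one_smul ℂ _)

variable {l s c}
  (hll : ∀ n k v, l n (l k v) = l k (l n v) + ((k : ℂ) - n) • l (k + n) v + (c * cocycle n k) • v)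
  (hls : ∀ n k v, l n (s k v) = s k (l n v) + ((k : ℂ) - n) • s (k + n) v + (c * cocycle n k) • v)
  (hss : ∀ n k v, s n (s k v) = s k (s n v))

include hll hls hss in
theorem opMap_genBracket (a b : Gen) :
    opMap l s c (genBracket a b) = ⁅genOp l s c a, genOp l s c b⁆ := by
  rw [LieRing.of_associative_ring_bracket]
  ext v
  cases a <;> cases b <;>
    simp only [genBracket_LL, genBracket_LW, genBracket_WL, genBracket_WW, genBracket_z_left,
      genBracket_z_right, map_add, map_smul, map_zero, opMap_gen, genOp, LinearMap.add_apply,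
      LinearMap.sub_apply, LinearMap.smul_apply, Module.End.mul_apply, Module.End.one_apply,
      LinearMap.zero_apply, sub_self]
  · rw [hll]; module
  · rw [hls]; module
  · rename_i n k
    rw [hls k n, cocycle_symm n k, add_comm n k]; module
  · rw [hss, sub_self]

/-- The representation of `W(2,2)` given by operators that satisfy its relations. -/
def repOfOps : Alg →ₗ⁅ℂ⁆ Module.End ℂ N where
  toLinearMap := opMap l s c
  map_lie' := by
    intro x y
    change opMap l s c ⁅x, y⁆ = ⁅opMap l s c x, opMap l s c y⁆
    induction x using alg_induction with
    | h0 => simp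
    | hadd x x' hx hx' => rw [add_lie, map_add, map_add, hx, hx', add_lie]
    | hsmul t x hx => rw [smul_lie, map_smul, map_smul, hx, smul_lie]
    | hgen a =>
      induction y using alg_induction with
      | h0 => simp
      | hadd y y' hy hy' => rw [lie_add, map_add, map_add, hy, hy', lie_add]
      | hsmul t y hy => rw [lie_smul, map_smul, map_smul, hy, lie_smul]
      | hgen b => rw [lie_gen, opMap_genBracket hll hls hss, opMap_gen, opMap_gen]

theorem repOfOps_gen (a : Gen) : repOfOps hll hls hss (gen a) = genOp l s c a := opMap_gen l s c a

end RepOfOperators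

/-! ### Whittaker vectors with varying central charge -/

section Existence

open Fock

theorem end_eq_of_tmul {f g : Module.End ℂ (Fock ⊗[ℂ] Fock)} (h : ∀ p q, f (p ⊗ₜ q) = g (p ⊗ₜ q))
    (v : Fock ⊗[ℂ] Fock) : f v = g v :=
  LinearMap.congr_fun (TensorProduct.ext' h) v

/-- For each complex number `μ` there is a representation of `W(2,2)` in which `z` acts by
`charge 1 + charge μ`, with a Whittaker vector of prescribed type. -/
theorem exists_rep_with_charge (a b : ℤ → ℂ) (ha : ∀ n, 3 ≤ n → a n = 0)
    (hb : ∀ n, 3 ≤ n → b n = 0) (μ : ℂ) (hμ : μ ≠ -1) :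
    ∃ (ρ : Alg →ₗ⁅ℂ⁆ Module.End ℂ (Fock ⊗[ℂ] Fock)) (w : Fock ⊗[ℂ] Fock), w ≠ 0 ∧
      (∀ n, 0 < n → ρ (L n) w = a n • w) ∧ (∀ n, 0 < n → ρ (W n) w = b n • w) ∧
      ρ z = (charge 1 + charge μ) • 1 := by
  have hμ' : μ + 1 ≠ 0 := fun h => hμ (eq_neg_of_add_eq_zero_left h)
  -- The vacuum eigenvalue of `virT` is `density μ n 0 * ψ n`, with density -1 at n = 1 and -(μ + 1)
  -- at n = 2; this fixes `ψ` and requires μ ≠ -1.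
  set ψ : ℤ → ℂ := fun n => if n = 1 then -a 1 else -a 2 / (μ + 1) * if n = 2 then 1 else 0 with hψ
  have hψ3 : ∀ n, 3 ≤ n → ψ n = 0 := fun n hn => by
    simp [hψ, show n ≠ 1 by omega, show n ≠ 2 by omega]
  set c : ℂ := charge 1 + charge μ
  -- The first factor carries the W(n), and there the deformation parameter is the total charge, so
  -- both families of brackets see the same z. The second factor supplies the eigenvalues of L(n)
  -- and the adjustable charge.
  set l : ℤ → Module.End ℂ (Fock ⊗[ℂ] Fock) := fun n =>
    (virW hb c n).rTensor Fock + (virT hψ3 μ 1 n).lTensor Fock with hl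
  set s : ℤ → Module.End ℂ (Fock ⊗[ℂ] Fock) := fun n => (mode b n).rTensor Fock with hs
  have hlt : ∀ n p q, l n (p ⊗ₜ q) = virW hb c n p ⊗ₜ q + p ⊗ₜ virT hψ3 μ 1 n q := by
    intro n p q
    simp [hl]
  have hst : ∀ n p q, s n (p ⊗ₜ q) = mode b n p ⊗ₜ q := by
    intro n p q
    simp [hs]
  have hll : ∀ n k v, l n (l k v) =
      l k (l n v) + ((k : ℂ) - n) • l (k + n) v + (c * cocycle n k) • v := by
    intro n k v
    refine end_eq_of_tmul (f := l n * l k)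
      (g := l k * l n + ((k : ℂ) - n) • l (k + n) + (c * cocycle n k) • 1) (fun p q => ?_) v
    simp only [Module.End.mul_apply, LinearMap.add_apply, LinearMap.smul_apply,
      Module.End.one_apply, hlt, map_add]
    rw [virW_virW, virT_virT]
    simp only [TensorProduct.add_tmul, TensorProduct.tmul_add, TensorProduct.tmul_smul,
      ← TensorProduct.smul_tmul']
    module
  have hls : ∀ n k v, l n (s k v) =
      s k (l n v) + ((k : ℂ) - n) • s (k + n) v + (c * cocycle n k) • v := by
    intro n k v
    refine end_eq_of_tmul (f := l n * s k)
      (g := s k * l n + ((k : ℂ) - n) • s (k + n) + (c * cocycle n k) • 1) (fun p q => ?_) v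
    simp only [Module.End.mul_apply, LinearMap.add_apply, LinearMap.smul_apply,
      Module.End.one_apply, hlt, hst, map_add]
    rw [virW_mode]
    simp only [TensorProduct.add_tmul, ← TensorProduct.smul_tmul']
    module
  have hss : ∀ n k v, s n (s k v) = s k (s n v) := by
    intro n k v
    refine end_eq_of_tmul (f := s n * s k) (g := s k * s n) (fun p q => ?_) v
    simp only [Module.End.mul_apply, hst]
    rw [mode_mode]
  refine ⟨repOfOps hll hls hss, 1 ⊗ₜ 1, fun h0 => ?_, fun n hn => ?_, fun n hn => ?_, ?_⟩
  · have h := congrArg (TensorProduct.lid ℂ ℂ ∘ₗ TensorProduct.map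
      (MvPolynomial.aeval (0 : ℤ → ℂ)).toLinearMap (MvPolynomial.aeval (0 : ℤ → ℂ)).toLinearMap :
        Fock ⊗[ℂ] Fock →ₗ[ℂ] ℂ) h0
    simp at h
  · rw [repOfOps_gen, genOp, hlt, virW_one hb c hn, virT_one hψ3 μ 1 hn, TensorProduct.zero_tmul,
      zero_add, TensorProduct.tmul_smul]
    congr 1
    rcases lt_or_ge n 3 with h3 | h3
    · obtain rfl | rfl : n = 1 ∨ n = 2 := by omega
      · simp [hψ, density]
      · simp only [hψ, density]
        norm_num
        field_simp
        ring
    · rw [hψ3 n h3, ha n h3, mul_zero]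
  · rw [repOfOps_gen, genOp, hst, mode_one hn, TensorProduct.smul_tmul']
  · rw [repOfOps_gen, genOp]

end Existence

/-! ### Generators and central elements of the enveloping algebra -/

section Enveloping

/-- By the universal property, lifting `ι` into the subalgebra it generates and then including is
the identity. -/
theorem adjoin_range_ι (𝔤 : Type*) [LieRing 𝔤] [LieAlgebra ℂ 𝔤] :
    Algebra.adjoin ℂ
      (Set.range (UniversalEnvelopingAlgebra.ι ℂ : 𝔤 → UniversalEnvelopingAlgebra ℂ 𝔤)) = ⊤ := by
  set S := Algebra.adjoin ℂ
    (Set.range (UniversalEnvelopingAlgebra.ι ℂ : 𝔤 → UniversalEnvelopingAlgebra ℂ 𝔤))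
  let g : 𝔤 →ₗ⁅ℂ⁆ S :=
    { toFun := fun x => ⟨UniversalEnvelopingAlgebra.ι ℂ x, Algebra.subset_adjoin ⟨x, rfl⟩⟩
      map_add' := fun x y => Subtype.ext (map_add _ x y)
      map_smul' := fun c x => Subtype.ext (map_smul _ c x)
      map_lie' := fun {x y} => Subtype.ext (LieHom.map_lie _ x y) }
  have h : S.val.comp (UniversalEnvelopingAlgebra.lift ℂ g) =
      AlgHom.id ℂ (UniversalEnvelopingAlgebra ℂ 𝔤) := by
    refine UniversalEnvelopingAlgebra.hom_ext (R := ℂ) (L := 𝔤) ?_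
    ext x
    simp [g]
  refine Algebra.eq_top_iff.mpr fun u => ?_
  have h2 := AlgHom.congr_fun h u
  rw [AlgHom.id_apply] at h2
  rw [← h2]
  exact (UniversalEnvelopingAlgebra.lift ℂ g u).2

theorem enveloping_induction {𝔤 : Type*} [LieRing 𝔤] [LieAlgebra ℂ 𝔤]
    {p : UniversalEnvelopingAlgebra ℂ 𝔤 → Prop}
    (hι : ∀ x, p (UniversalEnvelopingAlgebra.ι ℂ x)) (hc : ∀ c, p (algebraMap ℂ _ c))
    (hadd : ∀ u v, p u → p v → p (u + v)) (hmul : ∀ u v, p u → p v → p (u * v))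
    (u : UniversalEnvelopingAlgebra ℂ 𝔤) : p u := by
  have hu : u ∈ Algebra.adjoin ℂ
      (Set.range (UniversalEnvelopingAlgebra.ι ℂ : 𝔤 → UniversalEnvelopingAlgebra ℂ 𝔤)) := by
    rw [adjoin_range_ι]; trivial
  induction hu using Algebra.adjoin_induction with
  | mem x hx => obtain ⟨y, rfl⟩ := hx; exact hι y
  | algebraMap c => exact hc c
  | add x y _ _ hx hy => exact hadd x y hx hy
  | mul x y _ _ hx hy => exact hmul x y hx hy

theorem commute_polyZ (q : Polynomial ℂ) (u : U) : Commute (polyZ q) u := by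
  have hz : ∀ x : Alg, ⁅(z : Alg), x⁆ = 0 := by
    intro x
    induction x using alg_induction with
    | h0 => simp
    | hadd x y hx hy => rw [lie_add, hx, hy, add_zero]
    | hsmul c x hx => rw [lie_smul, hx, smul_zero]
    | hgen a => rw [lie_gen, genBracket_z_left]
  have h : Commute (UniversalEnvelopingAlgebra.ι ℂ z : U) u := by
    induction u using enveloping_induction with
    | hι x =>
      have h1 := LieHom.map_lie (UniversalEnvelopingAlgebra.ι ℂ : Alg →ₗ⁅ℂ⁆ U) z x
      rw [hz, map_zero, LieRing.of_associative_ring_bracket] at h1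
      exact sub_eq_zero.mp h1.symm
    | hc c => exact Algebra.commute_algebraMap_right c _
    | hadd u v hu hv => exact hu.add_right hv
    | hmul u v hu hv => exact hu.mul_right hv
  rw [polyZ]
  induction q using Polynomial.induction_on' with
  | add p q hp hq => rw [map_add]; exact hp.add_left hq
  | monomial n c =>
    rw [Polynomial.aeval_monomial]
    exact (Algebra.commute_algebraMap_left c _).mul_left (h.pow_left n)

end Enveloping

/-! ### From modules over the enveloping algebra to representations -/

section Modules

variable (N : Type*) [AddCommGroup N] [Module ℂ N] [Module U N] [IsScalarTower ℂ U N]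

/-- The representation of `W(2,2)` on a module over its enveloping algebra. -/
def moduleRep : Alg →ₗ⁅ℂ⁆ Module.End ℂ N :=
  (AlgHom.toLieHom (Algebra.lsmul ℂ ℂ N : U →ₐ[ℂ] Module.End ℂ N)).comp
    (UniversalEnvelopingAlgebra.ι ℂ)

variable {N}

theorem moduleRep_apply (x : Alg) (v : N) :
    moduleRep N x v = (UniversalEnvelopingAlgebra.ι ℂ x : U) • v := rfl

theorem aeval_moduleRep_z (r : Polynomial ℂ) (v : N) :
    Polynomial.aeval (moduleRep N z) r v = polyZ r • v := by
  have h := Polynomial.aeval_algHom_apply (Algebra.lsmul ℂ ℂ N : U →ₐ[ℂ] Module.End ℂ N)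
    (UniversalEnvelopingAlgebra.ι ℂ z) r
  exact LinearMap.congr_fun h v

theorem Stable.smul_mem {S : Submodule ℂ N} (hS : Stable (moduleRep N) S) (u : U) {v : N}
    (hv : v ∈ S) : u • v ∈ S := by
  induction u using enveloping_induction generalizing v with
  | hι x =>
    induction x using alg_induction with
    | h0 => simp
    | hadd x y hx hy => rw [map_add, add_smul]; exact add_mem hx hy
    | hsmul c x hx => rw [map_smul, smul_assoc]; exact S.smul_mem c hx
    | hgen a => exact hS a v hv
  | hc c => rw [algebraMap_smul]; exact S.smul_mem c hv
  | hadd u u' hu hu' => rw [add_smul]; exact add_mem (hu hv) (hu' hv)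
  | hmul u u' hu hu' => rw [mul_smul]; exact hu (hu' hv)

theorem stable_restrictScalars (V : Submodule U N) :
    Stable (moduleRep N) (V.restrictScalars ℂ) := fun _ _ hv => V.smul_mem _ hv

end Modules

/-! ### Values of the character -/

section Character

variable (φ : Pos →ₗ⁅ℂ⁆ ℂ)

/-- The value of `φ` at `L n`. -/
def typeL (n : ℤ) : ℂ := if h : 0 < n then φ (posL n h) else 0

/-- The value of `φ` at `W n`. -/
def typeW (n : ℤ) : ℂ := if h : 0 < n then φ (posW n h) else 0

theorem typeL_eq {n : ℤ} (h : 0 < n) : typeL φ n = φ (posL n h) := dif_pos h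

theorem typeW_eq {n : ℤ} (h : 0 < n) : typeW φ n = φ (posW n h) := dif_pos h

theorem apply_lie_eq_zero (x y : Pos) : φ ⁅x, y⁆ = 0 := by
  rw [LieHom.map_lie, LieRing.of_associative_ring_bracket, mul_comm, sub_self]

/-- L(n) is a nonzero multiple of [L(1), L(n-1)] once n ≠ 2, and a character kills brackets. -/
theorem typeL_eq_zero {n : ℤ} (hn : 3 ≤ n) : typeL φ n = 0 := by
  have h := apply_lie_eq_zero φ (posL 1 one_pos) (posL (n - 1) (by omega))
  have h2 : ⁅posL 1 one_pos, posL (n - 1) (by omega)⁆ = ((n : ℂ) - 2) • posL n (by omega) := by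
    refine Subtype.ext ?_
    change ⁅L 1, L (n - 1)⁆ = ((n : ℂ) - 2) • L n
    rw [lie_gen, genBracket_LL, cocycle, if_neg (by omega), sub_add_cancel]
    push_cast
    module
  rw [h2, map_smul, ← typeL_eq] at h
  refine (smul_eq_zero.mp h).resolve_left (sub_ne_zero.mpr ?_)
  exact_mod_cast (show n ≠ 2 by omega)

theorem typeW_eq_zero {n : ℤ} (hn : 3 ≤ n) : typeW φ n = 0 := by
  have h := apply_lie_eq_zero φ (posL 1 one_pos) (posW (n - 1) (by omega))
  have h2 : ⁅posL 1 one_pos, posW (n - 1) (by omega)⁆ = ((n : ℂ) - 2) • posW n (by omega) := by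
    refine Subtype.ext ?_
    change ⁅L 1, W (n - 1)⁆ = ((n : ℂ) - 2) • W n
    rw [lie_gen, genBracket_LW, cocycle, if_neg (by omega), sub_add_cancel]
    push_cast
    module
  rw [h2, map_smul, ← typeW_eq] at h
  refine (smul_eq_zero.mp h).resolve_left (sub_ne_zero.mpr ?_)
  exact_mod_cast (show n ≠ 2 by omega)

variable {φ} in
theorem IsWhittakerVector.whittakerFor {N : Type*} [AddCommGroup N] [Module ℂ N] [Module U N]
    [IsScalarTower ℂ U N] {v : N} (hv : IsWhittakerVector φ v) (hφ : NonSingular φ) :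
    WhittakerFor (moduleRep N) v (typeL φ) (typeW φ) where
  rep_L n hn := by
    rw [moduleRep_apply, typeL_eq φ hn, ← algebraMap_smul U (φ (posL n hn)) v]
    exact hv (posL n hn)
  rep_W n hn := by
    rw [moduleRep_apply, typeW_eq φ hn, ← algebraMap_smul U (φ (posW n hn)) v]
    exact hv (posW n hn)
  eq_zero n hn := typeW_eq_zero φ hn
  ne_zero := by
    rw [typeW_eq φ two_pos]
    exact right_ne_zero_of_mul hφ.2

end Character

/-! ### The universal module and the nonvanishing of r(z)w -/

section Universal

variable (φ : Pos →ₗ⁅ℂ⁆ ℂ)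

theorem isWhittakerVector_w : IsWhittakerVector φ (w φ) := by
  intro x
  rw [w, ← map_smul, ← map_smul, ← sub_eq_zero, ← map_sub, Submodule.mkQ_apply,
    Submodule.Quotient.mk_eq_zero]
  refine Submodule.subset_span ⟨1, UniversalEnvelopingAlgebra.ι ℂ x, CPhi.one φ, ?_⟩
  rw [TensorProduct.smul_tmul', TensorProduct.smul_tmul', CPhi.ι_smul, one_mul, smul_eq_mul,
    smul_eq_mul, mul_one, mul_one, TensorProduct.tmul_smul, TensorProduct.smul_tmul',
    Algebra.algebraMap_eq_smul_one, inclU, UniversalEnvelopingAlgebra.lift_ι_apply]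
  rfl

theorem span_w : Submodule.span U {w φ} = ⊤ := by
  refine Submodule.eq_top_iff'.mpr fun v => ?_
  obtain ⟨t, rfl⟩ := (balancing φ).mkQ_surjective v
  induction t with
  | zero => simp
  | add s t hs ht => rw [map_add]; exact add_mem hs ht
  | tmul u c =>
    refine Submodule.mem_span_singleton.mpr ⟨(show ℂ from c) • u, ?_⟩
    rw [w, ← map_smul, TensorProduct.smul_tmul', smul_eq_mul, mul_one,
      TensorProduct.smul_tmul]
    congr 2
    exact mul_one (show ℂ from c)

section Functional

variable {E : Type*} [AddCommGroup E] [Module ℂ E] (ρ : Alg →ₗ⁅ℂ⁆ Module.End ℂ E) (e : E)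

/-- The map `U ⊗ ℂ_φ → E` that sends `u ⊗ c` to `c u e`. -/
def orbitMap : U ⊗[ℂ] CPhi φ →ₗ[ℂ] E :=
  TensorProduct.lift (LinearMap.mk₂ ℂ
    (fun (u : U) (c : CPhi φ) => (show ℂ from c) • UniversalEnvelopingAlgebra.lift ℂ ρ u e)
    (fun u u' c => by rw [map_add, LinearMap.add_apply, smul_add])
    (fun t u c => by rw [map_smul, LinearMap.smul_apply, smul_comm])
    (fun u c c' => add_smul (show ℂ from c) (show ℂ from c') _)
    (fun t u c => mul_smul t (show ℂ from c) _))

theorem orbitMap_tmul (u : U) (c : CPhi φ) : orbitMap φ ρ e (u ⊗ₜ c) =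
    (show ℂ from c) • UniversalEnvelopingAlgebra.lift ℂ ρ u e := rfl

theorem orbitMap_smul (u : U) (t : U ⊗[ℂ] CPhi φ) :
    orbitMap φ ρ e (u • t) = UniversalEnvelopingAlgebra.lift ℂ ρ u (orbitMap φ ρ e t) := by
  induction t with
  | zero => simp
  | add s t hs ht => rw [smul_add, map_add, map_add, hs, ht, map_add]
  | tmul u' c =>
    rw [TensorProduct.smul_tmul', smul_eq_mul, orbitMap_tmul, orbitMap_tmul, map_mul,
      Module.End.mul_apply, map_smul]

variable {φ ρ e} in
theorem lift_inclU_apply (he : ∀ x : Pos, ρ x e = φ x • e) (n : UPos) :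
    UniversalEnvelopingAlgebra.lift ℂ ρ (inclU n) e =
      UniversalEnvelopingAlgebra.lift ℂ φ n • e := by
  induction n using enveloping_induction with
  | hι x =>
    rw [inclU, UniversalEnvelopingAlgebra.lift_ι_apply, UniversalEnvelopingAlgebra.lift_ι_apply]
    change UniversalEnvelopingAlgebra.lift ℂ ρ (UniversalEnvelopingAlgebra.ι ℂ (x : Alg)) e = _
    rw [UniversalEnvelopingAlgebra.lift_ι_apply]
    exact he x
  | hc c => simp [Algebra.algebraMap_eq_smul_one]
  | hadd u v hu hv => simp only [map_add, LinearMap.add_apply, hu, hv, add_smul]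
  | hmul u v hu hv =>
    rw [map_mul, map_mul, map_mul, Module.End.mul_apply, hv, map_smul, hu, smul_smul, mul_comm]

variable {φ ρ e} in
theorem orbitMap_balancing (he : ∀ x : Pos, ρ x e = φ x • e) {t : U ⊗[ℂ] CPhi φ}
    (ht : t ∈ balancing φ) : orbitMap φ ρ e t = 0 := by
  induction ht using Submodule.span_induction with
  | mem t ht =>
    obtain ⟨u, n, c, rfl⟩ := ht
    rw [map_sub, orbitMap_tmul, orbitMap_tmul, map_mul, Module.End.mul_apply,
      lift_inclU_apply he, map_smul, smul_smul, mul_comm, sub_eq_zero]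
    rfl
  | zero => simp
  | add s t _ _ hs ht => rw [map_add, hs, ht, add_zero]
  | smul u t _ ht => rw [orbitMap_smul, ht, map_zero]

end Functional

/-- The charge is quadratic in its parameter with axis of symmetry -1/2, hence injective on the
natural numbers. -/
theorem infinite_range_charge :
    (Set.range fun n : ℕ => Fock.charge 1 + Fock.charge (n : ℂ)).Infinite := by
  refine Set.infinite_range_of_injective fun m n h => ?_
  simp only [Fock.charge] at h
  have h1 : ((m : ℂ) - n) * (m + n + 1) = 0 := by linear_combination h / 12
  rcases mul_eq_zero.mp h1 with h2 | h2
  · exact_mod_cast sub_eq_zero.mp h2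
  · exact absurd h2 (by exact_mod_cast (show m + n + 1 ≠ 0 by omega))

/-- If r(z)w = 0, the relation passes to each Fock representation, where z is a scalar and the
Whittaker vector is nonzero. So `r` vanishes at infinitely many charges. -/
theorem polyZ_smul_w_ne_zero {r : Polynomial ℂ} (hr : r ≠ 0) : polyZ r • w φ ≠ 0 := by
  intro h0
  refine hr (Polynomial.eq_zero_of_infinite_isRoot r (infinite_range_charge.mono ?_))
  rintro _ ⟨n, rfl⟩
  obtain ⟨ρ, e, he0, heL, heW, hz⟩ := exists_rep_with_charge (typeL φ) (typeW φ)
    (fun _ => typeL_eq_zero φ) (fun _ => typeW_eq_zero φ) (n : ℂ)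
    (fun h => by
      have h1 : ((n + 1 : ℕ) : ℂ) = 0 := by push_cast; rw [h]; ring
      exact absurd (Nat.cast_eq_zero.mp h1) (Nat.succ_ne_zero n))
  have he : ∀ x : Pos, ρ x e = φ x • e := by
    rintro ⟨x, hx⟩
    change x ∈ Submodule.span ℂ posGens at hx
    induction hx using Submodule.span_induction with
    | mem x hx =>
      obtain ⟨m, hm, rfl | rfl⟩ := hx
      · exact (heL m hm).trans (by rw [typeL_eq φ hm]; rfl)
      · exact (heW m hm).trans (by rw [typeW_eq φ hm]; rfl)
    | zero =>
      change ρ 0 e = φ 0 • e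
      simp
    | add x y hx hy h1 h2 =>
      change ρ (x + y) e = φ (⟨x, hx⟩ + ⟨y, hy⟩) • e
      rw [map_add, map_add, LinearMap.add_apply, add_smul]
      exact congrArg₂ (· + ·) h1 h2
    | smul c x hx h1 =>
      change ρ (c • x) e = φ (c • ⟨x, hx⟩) • e
      rw [map_smul, map_smul, LinearMap.smul_apply, smul_assoc]
      exact congrArg (c • ·) h1
  rw [w, ← map_smul, Submodule.mkQ_apply, Submodule.Quotient.mk_eq_zero] at h0
  have h1 := orbitMap_balancing he h0
  rw [orbitMap_smul, orbitMap_tmul, map_one, Module.End.one_apply, polyZ,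
    ← Polynomial.aeval_algHom_apply, UniversalEnvelopingAlgebra.lift_ι_apply, hz,
    ← Algebra.algebraMap_eq_smul_one, Polynomial.aeval_algebraMap_apply,
    Module.algebraMap_end_apply] at h1
  have h2 : (show ℂ from CPhi.one φ) = 1 := rfl
  rw [h2, one_smul] at h1
  simpa using (smul_eq_zero.mp h1).resolve_right he0

end Universal

/-! ### Classification of submodules -/

section Main

variable (φ : Pos →ₗ⁅ℂ⁆ ℂ)

theorem exists_polyZ_smul_mem (hφ : NonSingular φ) {N : Type*} [AddCommGroup N] [Module ℂ N]
    [Module U N] [IsScalarTower ℂ U N] {e : N} (he : IsWhittakerVector φ e)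
    (hgen : Submodule.span U {e} = ⊤) (V : Submodule U N) {v : N} (hv : v ∈ V) (hv0 : v ≠ 0) :
    ∃ r : Polynomial ℂ, polyZ r • e ∈ V ∧ polyZ r • e ≠ 0 := by
  obtain ⟨r, hr, hr0⟩ := (he.whittakerFor hφ).exists_aeval_mem (fun S hS heS =>
    Submodule.eq_top_iff'.mpr fun x => by
      obtain ⟨u, rfl⟩ := Submodule.mem_span_singleton.mp (hgen ▸ Submodule.mem_top : x ∈ _)
      exact hS.smul_mem u heS) (stable_restrictScalars V) hv hv0
  rw [aeval_moduleRep_z] at hr hr0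
  exact ⟨r, hr, hr0⟩

/-- The ideal of the polynomials `r` with `r(z) w ∈ V`. -/
def centralIdeal (V : Submodule U (M φ)) : Ideal (Polynomial ℂ) where
  carrier := {r | polyZ r • w φ ∈ V}
  zero_mem' := by simp [polyZ]
  add_mem' {p q} hp hq := by
    simp only [polyZ, Set.mem_ofPred_eq, map_add, add_smul] at *
    exact add_mem hp hq
  smul_mem' p q hq := by
    simp only [polyZ, Set.mem_ofPred_eq, smul_eq_mul, map_mul, mul_smul] at *
    exact V.smul_mem _ hq

theorem mem_centralIdeal {V : Submodule U (M φ)} {r : Polynomial ℂ} :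
    r ∈ centralIdeal φ V ↔ polyZ r • w φ ∈ V := Iff.rfl

theorem polyZ_mul (p q : Polynomial ℂ) : polyZ (p * q) = polyZ p * polyZ q := map_mul _ p q

theorem isWhittakerVector_polyZ_smul {N : Type*} [AddCommGroup N] [Module U N] {e : N}
    (he : IsWhittakerVector φ e) (q : Polynomial ℂ) : IsWhittakerVector φ (polyZ q • e) := by
  intro x
  rw [← mul_smul, ← (commute_polyZ q _).eq, mul_smul, he x, ← mul_smul, (commute_polyZ q _).eq,
    mul_smul]

/-- Otherwise `V` has nonzero image modulo `K`, and that image contains some nonzero class of r(z)w.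
Since `K` lies in `V`, r(z)w is in `V`, so q divides r and the class is zero after all. -/
theorem eq_span_polyZ_smul (hφ : NonSingular φ) (V : Submodule U (M φ)) (q : Polynomial ℂ)
    (hq : centralIdeal φ V = Ideal.span {q}) : V = Submodule.span U {polyZ q • w φ} := by
  have hqV : polyZ q • w φ ∈ V := by
    rw [← mem_centralIdeal, hq]
    exact Ideal.mem_span_singleton_self q
  refine le_antisymm (fun v hv => ?_) ((Submodule.span_singleton_le_iff_mem _ _).mpr hqV)
  by_contra hvK
  set K := Submodule.span U {polyZ q • w φ}
  have hwK : IsWhittakerVector φ (K.mkQ (w φ)) := fun x => by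
    rw [← map_smul, isWhittakerVector_w φ x, map_smul]
  have hgen : Submodule.span U {K.mkQ (w φ)} = ⊤ := by
    rw [← Set.image_singleton, Submodule.span_image, span_w, Submodule.map_top, Submodule.range_mkQ]
  obtain ⟨r, hr, hr0⟩ := exists_polyZ_smul_mem φ hφ hwK hgen (V.map K.mkQ)
    (Submodule.mem_map_of_mem hv) (by simpa using hvK)
  obtain ⟨v', hv', hvr⟩ := hr
  rw [← map_smul, ← sub_eq_zero, ← map_sub, Submodule.mkQ_apply,
    Submodule.Quotient.mk_eq_zero] at hvr
  have hrV : polyZ r • w φ ∈ V := by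
    have h := sub_mem hv' ((Submodule.span_singleton_le_iff_mem _ _).mpr hqV hvr)
    rwa [sub_sub_cancel] at h
  rw [← mem_centralIdeal, hq, Ideal.mem_span_singleton] at hrV
  obtain ⟨s, rfl⟩ := hrV
  apply hr0
  rw [← map_smul, Submodule.mkQ_apply, Submodule.Quotient.mk_eq_zero, mul_comm, polyZ_mul, mul_smul]
  exact K.smul_mem _ (Submodule.mem_span_singleton_self _)

/-- Multiplication by `q(z)`. -/
def mulPolyZ (q : Polynomial ℂ) : M φ →ₗ[U] M φ where
  toFun m := polyZ q • m
  map_add' := smul_add _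
  map_smul' u m := by rw [RingHom.id_apply, ← mul_smul, ← mul_smul, (commute_polyZ q u).eq]

/-- A nonzero kernel would contain a nonzero r(z)w, giving (qr)(z)w = 0 with qr ≠ 0. -/
theorem mulPolyZ_injective (hφ : NonSingular φ) {q : Polynomial ℂ} (hq : q ≠ 0) :
    Function.Injective (mulPolyZ φ q) := by
  rw [← LinearMap.ker_eq_bot, Submodule.eq_bot_iff]
  intro m hm
  by_contra hm0
  obtain ⟨r, hr, hr0⟩ := exists_polyZ_smul_mem φ hφ (isWhittakerVector_w φ) (span_w φ)
    (LinearMap.ker (mulPolyZ φ q)) hm hm0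
  have hr' : r ≠ 0 := by
    rintro rfl
    simp [polyZ] at hr0
  refine polyZ_smul_w_ne_zero φ (mul_ne_zero hq hr') ?_
  rw [polyZ_mul, mul_smul]
  exact hr

theorem range_mulPolyZ (q : Polynomial ℂ) :
    LinearMap.range (mulPolyZ φ q) = Submodule.span U {polyZ q • w φ} := by
  rw [← Submodule.map_top, ← span_w, Submodule.map_span, Set.image_singleton]
  rfl

end Main

end W22

end

theorem theorem5p2p2 (φ : W22.Pos →ₗ⁅ℂ⁆ ℂ) (hφ : W22.NonSingular φ)
    (V : Submodule W22.U (W22.M φ)) (hV : V ≠ ⊥) :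
    Nonempty (V ≃ₗ[W22.U] W22.M φ) ∧
      ∃ q : Polynomial ℂ,
        W22.IsWhittakerVector φ (W22.polyZ q • W22.w φ) ∧
          V = Submodule.span W22.U {W22.polyZ q • W22.w φ} := by
  -- ℂ[z] is a principal ideal domain, so a single q describes the intersection of `V` with ℂ[z]w.
  obtain ⟨q, hq⟩ := (IsPrincipalIdealRing.principal (W22.centralIdeal φ V)).principal
  have hVq := W22.eq_span_polyZ_smul φ hφ V q hq
  have hq0 : q ≠ 0 := by
    rintro rfl
    apply hV
    rw [hVq]
    simp [W22.polyZ]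
  refine ⟨⟨?_⟩, q, W22.isWhittakerVector_polyZ_smul φ (W22.isWhittakerVector_w φ) q, hVq⟩
  exact (LinearEquiv.ofEq _ _ (hVq.trans (W22.range_mulPolyZ φ q).symm)).trans
    (LinearEquiv.ofInjective _ (W22.mulPolyZ_injective φ hφ hq0)).symm
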